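/- Let $d\ge 1$ and $\ell\in\mathbb R^d\setminus\{0\}$. An environment is a family $\omega=(\pi_{ij})_{i,j\in\mathbb Z^d}$ of numbers $\pi_{ij}\in[0,1]$ with $\sum_j\pi_{ij}=1$ for every $i$. Let $\Omega$ be the space of environments, with the product topology, the product $\sigma$-field and the shifts $(T^k\omega)_{i,j}=\omega_{k+i,k+j}$, $k\in\mathbb Z^d$; write $\omega_x=(\omega_{xj})_{j}$. For $\omega\in\Omega$, $P_x^\omega$ is the law of the Markov chain $(X_n)_{n\ge0}$ on $\mathbb Z^d$ started at $x$ with transition probabilities $\pi_{ij}(\omega)$. Given a probability measure $\mathbb P$ on $\Omega$, $P_0=\int P_0^\omega\,d\mathbb P(\omega)$ is the annealed law (under which $\omega$ has law $\mathbb P$ and, given $\omega$, $(X_n)$ has law $P_0^\omega$). A probability measure $\nu$ on $\Omega$ is invariant for the environment process $(T^{X_n}\omega)_{n\ge0}$ if $\int \sum_{e}\pi_{0e}(\omega)\mathbf 1_A(T^e\omega)\,d\nu(\omega)=\nu(A)$ for all measurable $A$. For $k\in\mathbb Z$ let $H_k=\{x\in\mathbb Z^d: x\cdot\ell\ge k\}$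 and $\mathfrak S_k=\sigma(\omega_x: x\in H_k)$; a measure $\nu$ is absolutely continuous relative to $\mu$ in $H_k$ if $\nu|_{\mathfrak S_k}\ll\mu|_{\mathfrak S_k}$. The drift is $D(\omega)=\sum_i i\,\pi_{0i}(\omega)$. **Theorem.** Let $\mathbb P$ be a probability measure on $\Omega$ that is invariant and ergodic under $(T^k)_{k\in\mathbb Z^d}$ and has finite range $M<\infty$, that is, $\mathbb P(\pi_{ij}=0\text{ whenever }|i-j|>M)=1$. Assume the weak ellipticity condition $\mathbb P(\pi_{0j}>0\text{ for all }j\text{ with }j\cdot\ell\ge0\text{ and }|j|=1)=1$, and $P_0(\lim_{n\to\infty}X_n\cdot\ell=\infty)=1$. Suppose that $\mathbb P_\infty$ is a probability measure on $\Omega$ that is invariant for the environment process and absolutely continuous relative to $\mathbb P$ in every half-space $H_k$, $k\le0$. Then: 1. $\mathbb P$ and $\mathbb P_\infty$ are mutually absolutely continuous in every $H_k$, $k\le0$. 2. The Markov process $(T^{X_n}\omega)_{n\ge0}$ with initial distribution $\mathbb P_\infty$ is ergodic, that is, its law on $\Omega^{\mathbb N}$ is invariant and ergodic under the time shift. 3.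 $\mathbb P_\infty$ is the only probability measure that is invariant for the environment process and absolutely continuous relative to $\mathbb P$ in every $H_k$, $k\le 0$; and the measures $\tilde{\mathbb P}_n(A)=n^{-1}\sum_{m=1}^n P_0(T^{X_m}\omega\in A)$ converge weakly to $\mathbb P_\infty$. 4. $D$ is $\mathbb P_\infty$-integrable and $P_0\bigl(\lim_{n\to\infty}X_n/n=\mathbb E^{\mathbb P_\infty}(D)\bigr)=1$. -/

import Mathlib

open MeasureTheory ProbabilityTheory Filter Topology
open scoped ENNReal

namespace RWRE

/-- The lattice `ℤ^d`. -/
abbrev Lattice (d : ℕ) : Type := Fin d → ℤ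

/-- The inclusion of `ℤ^d` into Euclidean space `ℝ^d`. -/
noncomputable def Lattice.toE {d : ℕ} (x : Lattice d) : EuclideanSpace ℝ (Fin d) :=
  WithLp.toLp 2 fun i => (x i : ℝ)

/-- The space `Ω` of environments: families of transition probabilities `ω i j = π_{ij}` on `ℤ^d`.
As a subtype of a product it carries the product topology and the product `σ`-field. -/
abbrev Environment (d : ℕ) : Type :=
  {ω : Lattice d → Lattice d → ℝ // (∀ i j, 0 ≤ ω i j) ∧ ∀ i, HasSum (ω i) 1}

variable {d : ℕ}

/-- The natural shift `(T^k ω)_{ij} = ω_{k+i,k+j}`. -/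
def shift (k : Lattice d) (ω : Environment d) : Environment d :=
  ⟨fun i j => ω.1 (k + i) (k + j), fun i j => ω.2.1 (k + i) (k + j), fun i =>
    (Equiv.addLeft k).hasSum_iff.mpr (ω.2.2 (k + i))⟩

/-- The action of `ℤ^d` on environments by the shifts. -/
instance : AddAction (Lattice d) (Environment d) where
  vadd := shift
  zero_vadd ω := Subtype.ext <| funext₂ fun i j => by
    change ω.1 (0 + i) (0 + j) = ω.1 i j
    rw [zero_add, zero_add]
  add_vadd k l ω := Subtype.ext <| funext₂ fun i j => by
    change ω.1 (k + l + i) (k + l + j) = ω.1 (l + (k + i)) (l + (k + j))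
    rw [add_comm k l, add_assoc, add_assoc]

/-- The law of one step of the walk in the environment `ω` from the site `i`:
the measure `∑_j π_{ij} δ_j`. -/
noncomputable def stepLaw (ω : Environment d) (i : Lattice d) : Measure (Lattice d) :=
  Measure.sum fun j => ENNReal.ofReal (ω.1 i j) • Measure.dirac j

instance isProbabilityMeasure_stepLaw (ω : Environment d) (i : Lattice d) :
    IsProbabilityMeasure (stepLaw ω i) := by
  constructor
  rw [stepLaw, Measure.sum_apply _ MeasurableSet.univ]
  simp only [Measure.smul_apply, measure_univ, smul_eq_mul, mul_one]
  rw [← ENNReal.ofReal_tsum_of_nonneg (ω.2.1 i) (ω.2.2 i).summable, (ω.2.2 i).tsum_eq,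
    ENNReal.ofReal_one]

theorem measurable_coord (i j : Lattice d) : Measurable fun ω : Environment d => ω.1 i j :=
  (measurable_pi_apply j).comp ((measurable_pi_apply i).comp measurable_subtype_coe)

theorem measurable_stepLaw :
    Measurable fun p : Environment d × Lattice d => stepLaw p.1 p.2 := by
  refine measurable_from_prod_countable_left fun i => ?_
  refine Measure.measurable_of_measurable_coe _ fun s hs => ?_
  simp only [stepLaw, Measure.sum_apply _ hs, Measure.smul_apply, smul_eq_mul]
  exact Measurable.tsum fun j =>
    (ENNReal.measurable_ofReal.comp (measurable_coord i j)).mul_const _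

/-- The transition kernel of the walk in the environment `ω`. -/
noncomputable def stepKernel (ω : Environment d) : Kernel (Lattice d) (Lattice d) where
  toFun := stepLaw ω
  measurable' := measurable_of_countable _

instance (ω : Environment d) : IsMarkovKernel (stepKernel ω) :=
  ⟨fun i => inferInstanceAs (IsProbabilityMeasure (stepLaw ω i))⟩

/-- The transition kernel of the walk, read as a function of the path up to time `n`
(it depends only on the position at time `n`). -/
noncomputable def pathKernel (ω : Environment d) (n : ℕ) :
    Kernel (Π _ : Finset.Iic n, Lattice d) (Lattice d) :=
  (stepKernel ω).comap (fun h => h ⟨n, Finset.mem_Iic.2 le_rfl⟩) (by fun_prop)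

instance (ω : Environment d) (n : ℕ) : IsMarkovKernel (pathKernel ω n) := by
  rw [pathKernel]; infer_instance

/-- The quenched law `P_x^ω`: the law on path space of the Markov chain started at `x` with
transition probabilities `π_{ij}(ω)`. -/
noncomputable def quenched (x : Lattice d) (ω : Environment d) : Measure (ℕ → Lattice d) :=
  Kernel.trajMeasure (X := fun _ => Lattice d) (Measure.dirac x) (pathKernel ω)

instance (x : Lattice d) (ω : Environment d) : IsProbabilityMeasure (quenched x ω) := by
  rw [quenched]; infer_instance

/-- The restriction of a path to the times `0, …, n`. -/
def pathUpTo (n : ℕ) (y : ℕ → Lattice d) : Π _ : Finset.Iic n, Lattice d := fun i => y i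

theorem measurable_pathUpTo (n : ℕ) : Measurable (pathUpTo (d := d) n) :=
  measurable_pi_lambda _ fun i => measurable_pi_apply (i : ℕ)

theorem map_pathUpTo_zero_quenched (x : Lattice d) (ω : Environment d) :
    (quenched x ω).map (pathUpTo 0) =
      (Measure.dirac x).map (MeasurableEquiv.piUnique fun _ : Finset.Iic 0 => Lattice d).symm := by
  change (quenched x ω).map (Preorder.frestrictLe 0) = _
  rw [quenched, Kernel.trajMeasure, Measure.map_comp _ _ (by fun_prop), Kernel.traj_map_frestrictLe,
    Kernel.partialTraj_self, Measure.id_comp]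

/-- The Markov property: given the path up to time `n`, the next position has law
`∑_j π_{X_n j} δ_j`. -/
theorem quenched_markov (x : Lattice d) (ω : Environment d) (n : ℕ) :
    (quenched x ω).map (pathUpTo n) ⊗ₘ pathKernel ω n =
      (quenched x ω).map fun y => (pathUpTo n y, y (n + 1)) :=
  Kernel.map_frestrictLe_trajMeasure_compProd_eq_map_trajMeasure

theorem measurable_map_pathUpTo_quenched (x : Lattice d) (n : ℕ) :
    Measurable fun ω : Environment d => (quenched x ω).map (pathUpTo n) := by
  induction n with
  | zero =>
    simp only [map_pathUpTo_zero_quenched]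
    exact measurable_const
  | succ n ih =>
    let L : Kernel (Environment d) (Π _ : Finset.Iic n, Lattice d) :=
      ⟨fun ω => (quenched x ω).map (pathUpTo n), ih⟩
    have hL : IsMarkovKernel L := ⟨fun ω =>
      Measure.isProbabilityMeasure_map (measurable_pathUpTo n).aemeasurable⟩
    let S : Kernel (Environment d × Lattice d) (Lattice d) := ⟨_, measurable_stepLaw⟩
    have hS : IsMarkovKernel S := ⟨fun p => isProbabilityMeasure_stepLaw p.1 p.2⟩
    let K : Kernel (Environment d × (Π _ : Finset.Iic n, Lattice d)) (Lattice d) :=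
      S.comap (Prod.map id fun h => h ⟨n, Finset.mem_Iic.2 le_rfl⟩)
        (measurable_id.prodMap (measurable_pi_apply _))
    have hK : IsMarkovKernel K := Kernel.IsMarkovKernel.comap _ _
    let g : (Π _ : Finset.Iic n, Lattice d) × Lattice d → (Π _ : Finset.Iic (n + 1), Lattice d) :=
      fun p i => if h : i.1 ≤ n then p.1 ⟨i.1, Finset.mem_Iic.2 h⟩ else p.2
    have hg : Measurable g := by
      refine measurable_pi_lambda _ fun i => ?_
      by_cases h : i.1 ≤ n
      · simp only [g, h, dite_true]
        exact (measurable_pi_apply _).comp measurable_fst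
      · simp only [g, h, dite_false]
        exact measurable_snd
    have key : (fun ω : Environment d => (quenched x ω).map (pathUpTo (n + 1))) =
        fun ω => ((L ⊗ₖ K).map g) ω := by
      funext ω
      have h1 : (L ⊗ₖ K) ω = (quenched x ω).map (pathUpTo n) ⊗ₘ pathKernel ω n := by
        have : IsProbabilityMeasure ((quenched x ω).map (pathUpTo n)) :=
          Measure.isProbabilityMeasure_map (measurable_pathUpTo n).aemeasurable
        ext s hs
        rw [Kernel.compProd_apply hs, Measure.compProd_apply hs]
        rfl
      rw [Kernel.map_apply _ hg, h1, quenched_markov,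
        Measure.map_map hg ((measurable_pathUpTo n).prodMk (measurable_pi_apply _))]
      congr 1
      funext y
      funext i
      simp only [g, Function.comp_apply, pathUpTo]
      split_ifs with h
      · rfl
      · have := Finset.mem_Iic.1 i.2
        have h2 : i.1 = n + 1 := by omega
        rw [h2]
    rw [key]
    exact Kernel.measurable _

theorem measurable_quenched (x : Lattice d) : Measurable (quenched x) := by
  refine Measurable.measure_of_isPiSystem_of_isProbabilityMeasure
    (generateFrom_measurableCylinders (α := fun _ : ℕ => Lattice d)).symm
    isPiSystem_measurableCylinders fun s hs => ?_
  obtain ⟨N, S, mS, rfl⟩ := (mem_measurableCylinders _).1 hs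
  have hN : N ⊆ Finset.Iic (N.sup id) := N.subset_Iic_sup_id
  let r : (Π _ : Finset.Iic (N.sup id), Lattice d) → (Π _ : N, Lattice d) :=
    fun h i => h ⟨i.1, hN i.2⟩
  have hr : Measurable r := measurable_pi_lambda _ fun i => measurable_pi_apply _
  have h : ∀ ω : Environment d, quenched x ω (cylinder N S) =
      (quenched x ω).map (pathUpTo (N.sup id)) (r ⁻¹' S) := by
    intro ω
    rw [Measure.map_apply (measurable_pathUpTo _) (hr mS)]
    rfl
  simp only [h]
  exact (Measure.measurable_coe (hr mS)).comp (measurable_map_pathUpTo_quenched x _)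

/-- The quenched laws `P_x^ω`, as a kernel in `ω`. -/
noncomputable def quenchedKernel (x : Lattice d) : Kernel (Environment d) (ℕ → Lattice d) :=
  ⟨quenched x, measurable_quenched x⟩

instance (x : Lattice d) : IsMarkovKernel (quenchedKernel x) :=
  ⟨fun ω => inferInstanceAs (IsProbabilityMeasure (quenched x ω))⟩

/-- The annealed law `P_0` with environment law `μ`, as the joint law of the environment `ω` and
the walk `(X_n)` started at `0`: first `ω` is drawn from `μ`, then `(X_n)` from `P_0^ω`. -/
noncomputable def annealed (μ : Measure (Environment d)) :
    Measure (Environment d × (ℕ → Lattice d)) :=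
  μ ⊗ₘ quenchedKernel 0

/-- The environment process `(T^{X_n} ω)_n`, as a function of the environment and the walk. -/
def envProcess (p : Environment d × (ℕ → Lattice d)) : ℕ → Environment d :=
  fun n => shift (p.2 n) p.1

theorem measurable_shift : Measurable fun p : Environment d × Lattice d => shift p.2 p.1 := by
  refine measurable_from_prod_countable_left fun k => ?_
  exact Measurable.subtype_mk (measurable_pi_lambda _ fun i => measurable_pi_lambda _ fun j =>
    measurable_coord (k + i) (k + j))

theorem measurable_envProcess : Measurable (envProcess (d := d)) :=
  measurable_pi_lambda _ fun n => measurable_shift.comp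
    (by fun_prop : Measurable fun p : Environment d × (ℕ → Lattice d) => (p.1, p.2 n))

/-- The law of the environment process when the initial environment has law `μ`. -/
noncomputable def envProcessLaw (μ : Measure (Environment d)) : Measure (ℕ → Environment d) :=
  (annealed μ).map envProcess

/-- The transition kernel of the environment process:
`π(ω, A) = ∑_e π_{0e}(ω) 1_A(T^e ω)`. -/
noncomputable def envKernel : Kernel (Environment d) (Environment d) where
  toFun ω := Measure.sum fun e => ENNReal.ofReal (ω.1 0 e) • Measure.dirac (shift e ω)
  measurable' := by
    refine Measure.measurable_of_measurable_coe _ fun s hs => ?_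
    simp only [Measure.sum_apply _ hs, Measure.smul_apply, smul_eq_mul]
    refine Measurable.tsum fun e =>
      (ENNReal.measurable_ofReal.comp (measurable_coord 0 e)).mul ?_
    exact (Measure.measurable_coe hs).comp (Measure.measurable_dirac.comp
      (measurable_shift.comp (by fun_prop :
        Measurable fun ω : Environment d => (ω, e))))

/-- The `n`-th Cesàro average `n⁻¹ ∑_{m=1}^n P_0(T^{X_m} ω ∈ ·)` of the laws of the environment
seen from the particle. -/
noncomputable def cesaro (μ : Measure (Environment d)) (n : ℕ) : Measure (Environment d) :=
  (n : ℝ≥0∞)⁻¹ • ∑ m ∈ Finset.Icc 1 n, (annealed μ).map fun p => envProcess p m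

instance (μ : Measure (Environment d)) [IsProbabilityMeasure μ] (n : ℕ) :
    IsProbabilityMeasure (cesaro μ (n + 1)) := by
  have h : ∀ m, (annealed μ).map (fun p => envProcess p m) Set.univ = 1 := fun m => by
    have : IsProbabilityMeasure (annealed μ) := by rw [annealed]; infer_instance
    have hm : Measurable fun p : Environment d × (ℕ → Lattice d) => envProcess p m :=
      (measurable_pi_apply m).comp measurable_envProcess
    rw [Measure.map_apply hm MeasurableSet.univ, Set.preimage_univ, measure_univ]
  constructor
  rw [cesaro, Measure.smul_apply, Measure.finsetSum_apply]
  simp only [h, Finset.sum_const, Nat.card_Icc, Nat.add_sub_cancel, nsmul_eq_mul, mul_one,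
    smul_eq_mul]
  exact ENNReal.inv_mul_cancel (by simp) (ENNReal.natCast_ne_top _)

/-- The Cesàro average `(n + 1)⁻¹ ∑_{m=1}^{n+1} P_0(T^{X_m} ω ∈ ·)` as a probability measure; the
index is shifted by one so that it is positive. -/
noncomputable def cesaroProb (μ : Measure (Environment d)) [IsProbabilityMeasure μ] (n : ℕ) :
    ProbabilityMeasure (Environment d) :=
  ⟨cesaro μ (n + 1), inferInstance⟩

/-- The environment is `μ`-a.s. of range at most `M`. -/
def FiniteRange (M : ℝ) (μ : Measure (Environment d)) : Prop :=
  ∀ᵐ ω ∂μ, ∀ i j : Lattice d, M < ‖(i - j).toE‖ → ω.1 i j = 0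

/-- Weak ellipticity in direction `ℓ`. -/
def WeaklyElliptic (ℓ : EuclideanSpace ℝ (Fin d)) (μ : Measure (Environment d)) : Prop :=
  ∀ᵐ ω ∂μ, ∀ j : Lattice d, 0 ≤ inner ℝ j.toE ℓ → ‖j.toE‖ = 1 → 0 < ω.1 0 j

/-- The `σ`-field `𝔖_k` generated by the `ω_x`, `x ∈ H_k = {x : x · ℓ ≥ k}`. -/
abbrev halfSpaceSigma (ℓ : EuclideanSpace ℝ (Fin d)) (k : ℤ) : MeasurableSpace (Environment d) :=
  ⨆ (x : Lattice d) (_ : (k : ℝ) ≤ inner ℝ x.toE ℓ),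
    MeasurableSpace.comap (fun ω : Environment d => ω.1 x) inferInstance

theorem halfSpaceSigma_le (ℓ : EuclideanSpace ℝ (Fin d)) (k : ℤ) :
    halfSpaceSigma ℓ k ≤ (inferInstance : MeasurableSpace (Environment d)) :=
  iSup₂_le fun x _ => ((measurable_pi_apply x).comp measurable_subtype_coe).comap_le

/-- `ν` is absolutely continuous relative to `μ` in the half-space `H_k`: the restriction of `ν`
to `𝔖_k` is absolutely continuous relative to that of `μ`. -/
def AbsContOn (ℓ : EuclideanSpace ℝ (Fin d)) (k : ℤ) (ν μ : Measure (Environment d)) : Prop :=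
  ν.trim (halfSpaceSigma_le ℓ k) ≪ μ.trim (halfSpaceSigma_le ℓ k)

/-- The drift `D(ω) = ∑_i i π_{0i}(ω)`. -/
noncomputable def drift (ω : Environment d) : EuclideanSpace ℝ (Fin d) :=
  ∑' i : Lattice d, ω.1 0 i • i.toE

end RWRE

namespace RWRE

variable {d : ℕ}

/-! ### Finite-dimensional distributions and the first-step decomposition -/

/-! Write `θ` for `particleShift`, which performs one step and recentres environment and path at the
walker, and `u_E(ω) = P_0^ω((ω, X) ∈ E)` for a `θ`-invariant event `E`. If `ν` is invariant for the
environment process, then `annealed ν` is `θ`-invariant, `u_E` is harmonic, and `u_E ∈ {0, 1}` holds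
`ν`-a.s. (`quenchedProb_zero_or_one`). Hence `{u_E = 1}` is absorbing, and `ν` conditioned on it,
when possible, is again invariant (`invariant_cond`).

Absolute continuity can be reversed (`ac_symm`). By invariance and ellipticity, a `ν`-null
half-space event stays `ν`-null when pulled back along unit steps `e` with `e · ℓ ≥ 0`. The union of
all these pullbacks depends on the same half-space, and its complement is stable under such shifts.
Ergodicity of `μ` therefore makes the union `μ`-trivial, and full measure would contradict `ν ≪ μ`.

The remaining difficulty is that `μ` is not invariant for the environment process and can be
compared with `ν` only on half-spaces, while `u_E` may depend on the environment everywhere.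
Transience removes it: a transient path stays above some level `-K`, and the quenched probability of
`E` together with staying above `-K` depends on a half-space only, if `E` reads the environment near
the walk. Transience itself passes to `ν` by conditioning on the absorbing set where it fails
(`transient_invariant`). The result is `zero_one`: such an `E` has probability zero under both
annealed laws, or one under both.

Applied to the event that the upper limit of Birkhoff averages exceeds a level above the `ν`-mean,
`zero_one` and the maximal ergodic inequality give a law of large numbers under `annealed μ` with
limit the `ν`-mean. Frequencies of half-space events then determine `ν`, which is uniqueness.
Uniqueness applied to the conditioned laws gives ergodicity, dominated convergence gives the Cesàro
limit, and the truncated first step as observable gives the velocity. -/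

/-- The paths that agree with `p` at the times `0, …, n`. -/
def pathCylinder (n : ℕ) (p : ℕ → Lattice d) : Set (ℕ → Lattice d) :=
  {y | ∀ i ≤ n, y i = p i}

theorem measurableSet_pathCylinder (n : ℕ) (p : ℕ → Lattice d) :
    MeasurableSet (pathCylinder n p) := by
  have : pathCylinder n p = ⋂ i, ⋂ (_ : i ≤ n), (fun y : ℕ → Lattice d => y i) ⁻¹' {p i} := by
    ext y; simp [pathCylinder]
  rw [this]
  exact MeasurableSet.iInter fun i => MeasurableSet.iInter fun _ =>
    measurable_pi_apply i (MeasurableSet.singleton _)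

theorem pathUpTo_preimage_singleton (n : ℕ) (p : ℕ → Lattice d) :
    pathUpTo n ⁻¹' {pathUpTo n p} = pathCylinder n p := by
  ext y
  simp only [Set.mem_preimage, Set.mem_singleton_iff, funext_iff, pathUpTo, pathCylinder,
    Set.mem_ofPred_eq, Subtype.forall, Finset.mem_Iic]

theorem stepLaw_singleton (ω : Environment d) (i j : Lattice d) :
    stepLaw ω i {j} = ENNReal.ofReal (ω.1 i j) := by
  rw [stepLaw, Measure.sum_apply _ (MeasurableSet.singleton j)]
  simp only [Measure.smul_apply, smul_eq_mul, Measure.dirac_apply' _ (MeasurableSet.singleton j)]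
  rw [tsum_eq_single j]
  · simp
  · intro k hk
    simp [hk]

theorem quenched_pathCylinder (x : Lattice d) (ω : Environment d) (n : ℕ) (p : ℕ → Lattice d) :
    quenched x ω (pathCylinder n p) =
      if p 0 = x then ∏ i ∈ Finset.range n, ENNReal.ofReal (ω.1 (p i) (p (i + 1))) else 0 := by
  induction n with
  | zero =>
    rw [← pathUpTo_preimage_singleton, ← Measure.map_apply (measurable_pathUpTo 0)
      (MeasurableSet.singleton _), map_pathUpTo_zero_quenched,
      Measure.map_apply (MeasurableEquiv.measurable _) (MeasurableSet.singleton _),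
      Measure.dirac_apply' _ ((MeasurableEquiv.measurable _) (MeasurableSet.singleton _))]
    by_cases h : p 0 = x
    · rw [if_pos h, Set.indicator_of_mem]
      · simp
      · simp only [Set.mem_preimage, Set.mem_singleton_iff]
        funext i
        have hi : i.1 = 0 := by have := Finset.mem_Iic.1 i.2; omega
        rw [pathUpTo, hi, h]
        rfl
    · rw [if_neg h, Set.indicator_of_notMem]
      intro h'
      simp only [Set.mem_preimage, Set.mem_singleton_iff] at h'
      exact h (congrFun h' (default : Finset.Iic 0)).symm
  | succ n ih =>
    have h1 : pathCylinder (n + 1) p = (fun y => (pathUpTo n y, y (n + 1))) ⁻¹'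
        ({pathUpTo n p} ×ˢ {p (n + 1)}) := by
      ext y
      have := Set.ext_iff.1 (pathUpTo_preimage_singleton n p) y
      simp only [Set.mem_preimage, Set.mem_singleton_iff, Set.mem_prod] at this ⊢
      rw [this]
      simp only [pathCylinder, Set.mem_ofPred_eq]
      constructor
      · exact fun h => ⟨fun i hi => h i (by omega), h _ le_rfl⟩
      · rintro ⟨h, h'⟩ i hi
        rcases Nat.lt_or_ge n i with hlt | hge
        · obtain rfl : i = n + 1 := by omega
          exact h'
        · exact h i hge
    have : IsProbabilityMeasure ((quenched x ω).map (pathUpTo n)) :=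
      Measure.isProbabilityMeasure_map (measurable_pathUpTo n).aemeasurable
    rw [h1, ← Measure.map_apply ((measurable_pathUpTo n).prodMk (measurable_pi_apply _))
      ((MeasurableSet.singleton _).prod (MeasurableSet.singleton _)), ← quenched_markov,
      Measure.compProd_apply_prod (MeasurableSet.singleton _) (MeasurableSet.singleton _),
      lintegral_singleton, Measure.map_apply (measurable_pathUpTo n) (MeasurableSet.singleton _),
      pathUpTo_preimage_singleton, ih]
    have h2 : pathKernel ω n (pathUpTo n p) {p (n + 1)} = ENNReal.ofReal (ω.1 (p n) (p (n + 1))) :=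
      stepLaw_singleton ω _ _
    rw [h2, Finset.prod_range_succ]
    split_ifs
    · rw [mul_comm]
    · rw [mul_zero]

/-- Finite measures on path space are determined by the probabilities of the sets
`{X_0 = p_0, …, X_n = p_n}`. -/
theorem measure_ext_of_pathCylinder {P Q : Measure (ℕ → Lattice d)} [IsFiniteMeasure P]
    (h : ∀ n p, P (pathCylinder n p) = Q (pathCylinder n p)) : P = Q := by
  have h1 : ∀ n, P.map (pathUpTo n) = Q.map (pathUpTo n) := by
    intro n
    refine Measure.ext_of_singleton fun a => ?_
    -- The finite path `a` is continued as a constant after time `n`.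
    let p : ℕ → Lattice d := fun i => a ⟨min i n, by simp⟩
    have ha : a = pathUpTo n p := by
      funext i
      have := Finset.mem_Iic.1 i.2
      simp only [p]
      congr 1
      exact Subtype.ext (by simp [this])
    rw [Measure.map_apply (measurable_pathUpTo n) (MeasurableSet.singleton _),
      Measure.map_apply (measurable_pathUpTo n) (MeasurableSet.singleton _), ha,
      pathUpTo_preimage_singleton, h]
  refine ext_of_generate_finite _
    (generateFrom_measurableCylinders (α := fun _ : ℕ => Lattice d)).symm
    isPiSystem_measurableCylinders (fun s hs => ?_) ?_
  · obtain ⟨N, S, mS, rfl⟩ := (mem_measurableCylinders _).1 hs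
    have hN : N ⊆ Finset.Iic (N.sup id) := N.subset_Iic_sup_id
    let r : (Π _ : Finset.Iic (N.sup id), Lattice d) → (Π _ : N, Lattice d) :=
      fun h i => h ⟨i.1, hN i.2⟩
    have hr : Measurable r := measurable_pi_lambda _ fun i => measurable_pi_apply _
    have h2 := congrArg (fun m => m (r ⁻¹' S)) (h1 (N.sup id))
    simp only [Measure.map_apply (measurable_pathUpTo _) (hr mS)] at h2
    exact h2
  · have h2 := congrArg (fun m => m Set.univ) (h1 0)
    simpa only [Measure.map_apply (measurable_pathUpTo _) MeasurableSet.univ,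
      Set.preimage_univ] using h2

/-- The path that starts at `0` and then follows `e + y`. -/
def consPath (e : Lattice d) (y : ℕ → Lattice d) : ℕ → Lattice d
  | 0 => 0
  | n + 1 => e + y n

theorem measurable_consPath (e : Lattice d) : Measurable (consPath e) :=
  measurable_pi_lambda _ fun n => by
    cases n with
    | zero => exact measurable_const
    | succ n => exact measurable_const.add (measurable_pi_apply (X := fun _ : ℕ => Lattice d) n)

theorem tsum_ofReal_env (ω : Environment d) (i : Lattice d) :
    ∑' j, ENNReal.ofReal (ω.1 i j) = 1 := by
  rw [← ENNReal.ofReal_tsum_of_nonneg (ω.2.1 i) (ω.2.2 i).summable, (ω.2.2 i).tsum_eq,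
    ENNReal.ofReal_one]

theorem shift_apply (k : Lattice d) (ω : Environment d) (i j : Lattice d) :
    (shift k ω).1 i j = ω.1 (k + i) (k + j) := rfl

theorem shift_shift (k l : Lattice d) (ω : Environment d) :
    shift k (shift l ω) = shift (l + k) ω := by
  refine Subtype.ext <| funext₂ fun i j => ?_
  simp only [shift_apply, add_assoc]

theorem shift_zero (ω : Environment d) : shift 0 ω = ω := by
  refine Subtype.ext <| funext₂ fun i j => ?_
  simp only [shift_apply, zero_add]

theorem measurable_shift_const (k : Lattice d) : Measurable (shift k) :=
  measurable_shift.comp (by fun_prop : Measurable fun ω : Environment d => (ω, k))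

/-- First-step decomposition of the quenched law. -/
theorem quenched_zero_eq_sum (ω : Environment d) :
    quenched 0 ω = Measure.sum fun e =>
      ENNReal.ofReal (ω.1 0 e) • (quenched 0 (shift e ω)).map (consPath e) := by
  refine measure_ext_of_pathCylinder fun n p => ?_
  rw [quenched_pathCylinder, Measure.sum_apply _ (measurableSet_pathCylinder n p)]
  simp only [Measure.smul_apply, smul_eq_mul,
    Measure.map_apply (measurable_consPath _) (measurableSet_pathCylinder n p)]
  by_cases h : p 0 = 0
  · rw [if_pos h]
    cases n with
    | zero =>
      have : ∀ e, consPath e ⁻¹' pathCylinder 0 p = Set.univ := by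
        intro e
        ext y
        simp [pathCylinder, consPath, h]
      simp only [this, measure_univ, mul_one, tsum_ofReal_env, Finset.range_zero,
        Finset.prod_empty]
    | succ n =>
      have h1 : ∀ e, consPath e ⁻¹' pathCylinder (n + 1) p =
          pathCylinder n fun i => p (i + 1) - e := by
        intro e
        ext y
        simp only [Set.mem_preimage, pathCylinder, Set.mem_ofPred_eq]
        constructor
        · intro h' i hi
          rw [← h' (i + 1) (by omega)]
          simp [consPath]
        · intro h' i hi
          cases i with
          | zero => simp [consPath, h]
          | succ i => simp [consPath, h' i (by omega)]
      simp only [h1, quenched_pathCylinder, shift_apply, add_sub_cancel]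
      -- The shifted cylinder starts at `p 1 - e`, and the walk starts at `0`, so only `e = p 1`
      -- contributes.
      rw [tsum_eq_single (p 1), Finset.prod_range_succ', if_pos (sub_self _), h, mul_comm]
      intro e he
      rw [if_neg, mul_zero]
      exact fun h' => he (sub_eq_zero.1 h').symm
  · rw [if_neg h]
    have : ∀ e, consPath e ⁻¹' pathCylinder n p = ∅ := by
      intro e
      ext y
      simp only [Set.mem_preimage, pathCylinder, Set.mem_ofPred_eq, Set.mem_empty_iff_false,
        iff_false]
      exact fun h' => h (h' 0 (Nat.zero_le _)).symm
    simp only [this, measure_empty, mul_zero, tsum_zero]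

theorem lintegral_quenched_zero (ω : Environment d) {f : (ℕ → Lattice d) → ℝ≥0∞}
    (hf : Measurable f) :
    ∫⁻ y, f y ∂quenched 0 ω =
      ∑' e, ENNReal.ofReal (ω.1 0 e) * ∫⁻ y, f (consPath e y) ∂quenched 0 (shift e ω) := by
  rw [quenched_zero_eq_sum, lintegral_sum_measure]
  simp only [lintegral_smul_measure, smul_eq_mul, lintegral_map hf (measurable_consPath _)]

theorem ae_quenched_zero (ω : Environment d) : ∀ᵐ y ∂quenched 0 ω, y 0 = 0 := by
  rw [ae_iff, quenched_zero_eq_sum]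
  have hm : MeasurableSet {y : ℕ → Lattice d | ¬ y 0 = 0} :=
    (measurable_pi_apply (X := fun _ : ℕ => Lattice d) 0 (MeasurableSet.singleton 0)).compl
  rw [Measure.sum_apply _ hm]
  simp only [Measure.smul_apply, Measure.map_apply (measurable_consPath _) hm, smul_eq_mul,
    ENNReal.tsum_eq_zero]
  intro e
  have : consPath e ⁻¹' {y : ℕ → Lattice d | ¬ y 0 = 0} = ∅ := by
    ext y; simp [consPath]
  rw [this, measure_empty, mul_zero]

end RWRE

namespace RWRE

variable {d : ℕ}

/-! ### The shift on environment-path pairs -/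

theorem indicator_eq_indicator_of_iff {α β γ : Type*} [Zero γ] {s : Set α} {t : Set β}
    {f : α → γ} {g : β → γ} {x : α} {y : β} (h : x ∈ s ↔ y ∈ t) (hfg : f x = g y) :
    s.indicator f x = t.indicator g y := by
  by_cases hx : x ∈ s
  · rw [Set.indicator_of_mem hx, Set.indicator_of_mem (h.1 hx), hfg]
  · rw [Set.indicator_of_notMem hx, Set.indicator_of_notMem (mt h.2 hx)]

/-- One step of the environment-path pair seen from the particle. -/
def particleShift (z : Environment d × (ℕ → Lattice d)) : Environment d × (ℕ → Lattice d) :=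
  (shift (z.2 1) z.1, fun n => z.2 (n + 1) - z.2 1)

theorem measurable_pathCoord (n : ℕ) : Measurable fun y : ℕ → Lattice d => y n :=
  measurable_pi_apply n

theorem measurable_particleShift : Measurable (particleShift (d := d)) := by
  refine Measurable.prodMk ?_ (measurable_pi_lambda _ fun n => ?_)
  · exact measurable_shift.comp
      (measurable_fst.prodMk ((measurable_pathCoord 1).comp measurable_snd))
  · exact ((measurable_pathCoord _).comp measurable_snd).sub
      ((measurable_pathCoord 1).comp measurable_snd)

theorem particleShift_consPath (ω : Environment d) (e : Lattice d) {y : ℕ → Lattice d}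
    (hy : y 0 = 0) : particleShift (ω, consPath e y) = (shift e ω, y) := by
  simp [particleShift, consPath, hy]

/-- The formula fails for the zeroth iterate unless the path starts at `0`: the identity does not
recentre. From the first iterate on, no condition on the starting point is needed. -/
theorem particleShift_iterate_succ (n : ℕ) (z : Environment d × (ℕ → Lattice d)) :
    particleShift^[n + 1] z =
      (shift (z.2 (n + 1)) z.1, fun m => z.2 (m + (n + 1)) - z.2 (n + 1)) := by
  induction n with
  | zero => rfl
  | succ n ih =>
    rw [Function.iterate_succ_apply', ih]
    simp only [particleShift, shift_shift, Prod.mk.injEq]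
    refine ⟨by rw [add_sub_cancel, add_comm 1], funext fun m => ?_⟩
    rw [sub_sub_sub_cancel_right, show m + 1 + (n + 1) = m + (n + 1 + 1) by omega,
      add_comm 1 (n + 1)]

theorem particleShift_iterate_fst (n : ℕ) {z : Environment d × (ℕ → Lattice d)}
    (hz : z.2 0 = 0) : (particleShift^[n] z).1 = shift (z.2 n) z.1 := by
  cases n with
  | zero => rw [hz, shift_zero]; rfl
  | succ n => rw [particleShift_iterate_succ]

/-- The quenched probability of the event `E`. -/
noncomputable def quenchedProb (E : Set (Environment d × (ℕ → Lattice d))) (ω : Environment d) :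
    ℝ≥0∞ :=
  quenched 0 ω (Prod.mk ω ⁻¹' E)

theorem measurable_quenchedProb {E : Set (Environment d × (ℕ → Lattice d))}
    (hE : MeasurableSet E) : Measurable (quenchedProb E) :=
  Kernel.measurable_kernel_prodMk_left (κ := quenchedKernel 0) hE

theorem quenchedProb_le_one (E : Set (Environment d × (ℕ → Lattice d))) (ω : Environment d) :
    quenchedProb E ω ≤ 1 := prob_le_one

instance (ν : Measure (Environment d)) [IsProbabilityMeasure ν] :
    IsProbabilityMeasure (annealed ν) := by
  rw [annealed]; infer_instance

theorem annealed_apply (ν : Measure (Environment d)) [SFinite ν]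
    {E : Set (Environment d × (ℕ → Lattice d))} (hE : MeasurableSet E) :
    annealed ν E = ∫⁻ ω, quenchedProb E ω ∂ν :=
  Measure.compProd_apply hE

theorem lintegral_annealed (ν : Measure (Environment d)) [SFinite ν]
    {f : Environment d × (ℕ → Lattice d) → ℝ≥0∞} (hf : Measurable f) :
    ∫⁻ z, f z ∂annealed ν = ∫⁻ ω, ∫⁻ y, f (ω, y) ∂quenched 0 ω ∂ν :=
  Measure.lintegral_compProd hf

theorem ae_annealed_iff (ν : Measure (Environment d)) [SFinite ν]
    {p : Environment d × (ℕ → Lattice d) → Prop} (hp : MeasurableSet {z | p z}) :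
    (∀ᵐ z ∂annealed ν, p z) ↔ ∀ᵐ ω ∂ν, ∀ᵐ y ∂quenched 0 ω, p (ω, y) :=
  Measure.ae_compProd_iff hp

theorem ae_annealed_zero (ν : Measure (Environment d)) [SFinite ν] :
    ∀ᵐ z ∂annealed ν, z.2 0 = 0 := by
  refine (ae_annealed_iff ν ?_).2 (Eventually.of_forall fun ω => ae_quenched_zero ω)
  exact ((measurable_pathCoord 0).comp measurable_snd) (MeasurableSet.singleton 0)

theorem annealed_eq_one_iff (ν : Measure (Environment d)) [IsProbabilityMeasure ν]
    {E : Set (Environment d × (ℕ → Lattice d))} (hE : MeasurableSet E) :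
    (∀ᵐ z ∂annealed ν, z ∈ E) ↔ ∀ᵐ ω ∂ν, quenchedProb E ω = 1 := by
  refine (ae_annealed_iff ν (p := (· ∈ E)) hE).trans ?_
  refine eventually_congr (Eventually.of_forall fun ω => ?_)
  exact mem_ae_iff_prob_eq_one (measurable_prodMk_left hE)

theorem lintegral_envKernel (ω : Environment d) {f : Environment d → ℝ≥0∞} (hf : Measurable f) :
    ∫⁻ ω', f ω' ∂envKernel ω = ∑' e, ENNReal.ofReal (ω.1 0 e) * f (shift e ω) := by
  have : envKernel ω = Measure.sum fun e =>
      ENNReal.ofReal (ω.1 0 e) • Measure.dirac (shift e ω) := rfl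
  rw [this, lintegral_sum_measure]
  simp only [lintegral_smul_measure, smul_eq_mul, lintegral_dirac' _ hf]

instance : IsMarkovKernel (envKernel (d := d)) := ⟨fun ω => ⟨by
  rw [← lintegral_one, lintegral_envKernel ω measurable_const]
  simp only [mul_one, tsum_ofReal_env]⟩⟩

theorem envKernel_invariant_iff {ν : Measure (Environment d)} :
    envKernel.Invariant ν ↔ ∀ A, MeasurableSet A → ∫⁻ ω, envKernel ω A ∂ν = ν A := by
  rw [Kernel.Invariant, Measure.ext_iff]
  refine forall₂_congr fun A hA => ?_
  rw [Measure.bind_apply hA (Kernel.aemeasurable _)]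

theorem lintegral_envKernel_of_invariant {ν : Measure (Environment d)}
    (hν : envKernel.Invariant ν) {f : Environment d → ℝ≥0∞} (hf : Measurable f) :
    ∫⁻ ω, ∫⁻ ω', f ω' ∂envKernel ω ∂ν = ∫⁻ ω, f ω ∂ν := by
  conv_rhs => rw [← hν.def]
  rw [Measure.lintegral_bind (Kernel.aemeasurable _) hf.aemeasurable]

/-- The Markov property at time one: after a first step `e` the recentred pair is a walk from `0` in
`shift e ω`. This reduces invariance of `annealed ν` under `particleShift` to invariance of `ν`
under `envKernel`, and makes `u_E` harmonic. -/
theorem quenchedProb_particleShift_preimage {E : Set (Environment d × (ℕ → Lattice d))}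
    (hE : MeasurableSet E) (ω : Environment d) :
    quenchedProb (particleShift ⁻¹' E) ω = ∫⁻ ω', quenchedProb E ω' ∂envKernel ω := by
  have hE' := measurable_particleShift hE
  rw [lintegral_envKernel ω (measurable_quenchedProb hE), quenchedProb,
    ← lintegral_indicator_one (measurable_prodMk_left hE'),
    lintegral_quenched_zero ω (measurable_one.indicator (measurable_prodMk_left hE'))]
  refine tsum_congr fun e => ?_
  congr 1
  rw [quenchedProb, ← lintegral_indicator_one (measurable_prodMk_left hE)]
  refine lintegral_congr_ae ?_
  filter_upwards [ae_quenched_zero (shift e ω)] with y hy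
  refine indicator_eq_indicator_of_iff ?_ rfl
  rw [Set.mem_preimage, Set.mem_preimage, particleShift_consPath ω e hy, Set.mem_preimage]

theorem measurePreserving_particleShift {ν : Measure (Environment d)} [SFinite ν]
    (hν : envKernel.Invariant ν) :
    MeasurePreserving particleShift (annealed ν) (annealed ν) := by
  refine ⟨measurable_particleShift, Measure.ext fun E hE => ?_⟩
  rw [Measure.map_apply measurable_particleShift hE, annealed_apply ν hE,
    annealed_apply ν (measurable_particleShift hE)]
  simp only [quenchedProb_particleShift_preimage hE]
  exact lintegral_envKernel_of_invariant hν (measurable_quenchedProb hE)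

theorem quenchedProb_harmonic {E : Set (Environment d × (ℕ → Lattice d))}
    (hE : MeasurableSet E) (hinv : particleShift ⁻¹' E = E) (ω : Environment d) :
    ∫⁻ ω', quenchedProb E ω' ∂envKernel ω = quenchedProb E ω := by
  rw [← quenchedProb_particleShift_preimage hE, hinv]

/-! ### Zero-one law for shift-invariant events under an invariant law -/

/-- `C` depends on the path only up to time `n`. -/
def DependsUpTo (n : ℕ) (C : Set (ℕ → Lattice d)) : Prop :=
  ∀ y y' : ℕ → Lattice d, (∀ i ≤ n, y i = y' i) → (y ∈ C ↔ y' ∈ C)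

/-- The Markov property for shift-invariant events. -/
theorem quenched_inter_invariant {E : Set (Environment d × (ℕ → Lattice d))}
    (hE : MeasurableSet E) (hinv : particleShift ⁻¹' E = E) (n : ℕ) (ω : Environment d)
    {C : Set (ℕ → Lattice d)} (hC : MeasurableSet C) (hCn : DependsUpTo n C) :
    quenched 0 ω (C ∩ Prod.mk ω ⁻¹' E) =
      ∫⁻ y in C, quenchedProb E (shift (y n) ω) ∂quenched 0 ω := by
  induction n generalizing ω C with
  | zero =>
    -- An event decided by the position at time `0` has quenched probability `0` or `1`, since the
    -- walk starts at `0`.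
    by_cases h : (fun _ => 0) ∈ C
    · have h1 : ∀ᵐ y ∂quenched 0 ω, y ∈ C := by
        filter_upwards [ae_quenched_zero ω] with y hy
        exact (hCn _ _ fun i hi => by rw [Nat.le_zero.1 hi, hy]).1 h
      rw [Measure.restrict_eq_self_of_ae_mem h1]
      have h2 : ∫⁻ y, quenchedProb E (shift (y 0) ω) ∂quenched 0 ω =
          ∫⁻ _, quenchedProb E ω ∂quenched 0 ω := by
        refine lintegral_congr_ae ?_
        filter_upwards [ae_quenched_zero ω] with y hy
        rw [hy, shift_zero]
      rw [h2, lintegral_const, measure_univ, mul_one, quenchedProb]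
      refine measure_congr ?_
      filter_upwards [h1] with y hy
      exact propext ⟨fun h => h.2, fun h => ⟨hy, h⟩⟩
    · have h1 : quenched 0 ω C = 0 := by
        refine measure_mono_null (t := {y | ¬ y 0 = 0}) ?_ (ae_quenched_zero ω)
        intro y hy hy0
        exact h ((hCn _ _ fun i hi => by rw [Nat.le_zero.1 hi, hy0]).1 hy)
      rw [measure_mono_null Set.inter_subset_left h1, setLIntegral_measure_zero _ _ h1]
  | succ n ih =>
    have hu := measurable_quenchedProb hE
    have hf : Measurable fun y : ℕ → Lattice d => quenchedProb E (shift (y (n + 1)) ω) :=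
      hu.comp (measurable_shift.comp (measurable_const.prodMk (measurable_pathCoord _)))
    have hm : MeasurableSet (C ∩ Prod.mk ω ⁻¹' E) := hC.inter (measurable_prodMk_left hE)
    rw [← lintegral_indicator_one hm, ← lintegral_indicator hC,
      lintegral_quenched_zero ω (measurable_one.indicator hm),
      lintegral_quenched_zero ω (hf.indicator hC)]
    refine tsum_congr fun e => ?_
    congr 1
    have hCe : MeasurableSet (consPath e ⁻¹' C) := measurable_consPath e hC
    have h1 := ih (shift e ω) hCe fun y y' h => hCn _ _ fun i hi => by
      cases i with
      | zero => rfl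
      | succ i => simp only [consPath]; rw [h i (by omega)]
    rw [← lintegral_indicator_one (hCe.inter (measurable_prodMk_left hE)),
      ← lintegral_indicator hCe] at h1
    calc _ = _ := ?_
      _ = _ := h1
      _ = _ := ?_
    · refine lintegral_congr_ae ?_
      filter_upwards [ae_quenched_zero (shift e ω)] with y hy
      -- Invariance of `E` removes the first step, so the induction hypothesis applies in the
      -- environment `shift e ω`.
      have : (ω, consPath e y) ∈ E ↔ (shift e ω, y) ∈ E := by
        conv_lhs => rw [← hinv]
        rw [Set.mem_preimage, particleShift_consPath ω e hy]
      exact indicator_eq_indicator_of_iff (and_congr Iff.rfl this) rfl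
    · refine lintegral_congr fun y => ?_
      exact indicator_eq_indicator_of_iff Iff.rfl (by rw [shift_shift]; rfl)

/-- The measurable sets that depend on the path up to some finite time. -/
def finiteTimeSets (d : ℕ) : Set (Set (Environment d × (ℕ → Lattice d))) :=
  {C | MeasurableSet C ∧ ∃ n, ∀ ω, DependsUpTo n (Prod.mk ω ⁻¹' C)}

theorem isSetRing_finiteTimeSets : IsSetRing (finiteTimeSets d) where
  empty_mem := ⟨MeasurableSet.empty, 0, fun _ _ _ _ => Iff.rfl⟩
  union_mem := by
    rintro s t ⟨hs, n, hn⟩ ⟨ht, m, hm⟩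
    refine ⟨hs.union ht, max n m, fun ω y y' h => or_congr ?_ ?_⟩
    · exact hn ω y y' fun i hi => h i (le_max_of_le_left hi)
    · exact hm ω y y' fun i hi => h i (le_max_of_le_right hi)
  sdiff_mem := by
    rintro s t ⟨hs, n, hn⟩ ⟨ht, m, hm⟩
    refine ⟨hs.diff ht, max n m, fun ω y y' h => and_congr ?_ (not_congr ?_)⟩
    · exact hn ω y y' fun i hi => h i (le_max_of_le_left hi)
    · exact hm ω y y' fun i hi => h i (le_max_of_le_right hi)

theorem generateFrom_finiteTimeSets :
    (inferInstance : MeasurableSpace (Environment d × (ℕ → Lattice d))) =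
      MeasurableSpace.generateFrom (finiteTimeSets d) := by
  refine le_antisymm ?_ (MeasurableSpace.generateFrom_le fun s hs => hs.1)
  refine sup_le ?_ ?_
  · rintro _ ⟨s, hs, rfl⟩
    exact MeasurableSpace.measurableSet_generateFrom
      ⟨measurable_fst hs, 0, fun _ _ _ _ => Iff.rfl⟩
  · rw [MeasurableSpace.pi, MeasurableSpace.comap_iSup]
    refine iSup_le fun n => ?_
    rintro _ ⟨_, ⟨s, hs, rfl⟩, rfl⟩
    refine MeasurableSpace.measurableSet_generateFrom
      ⟨(measurable_pathCoord n).comp measurable_snd hs, n, fun ω y y' h => ?_⟩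
    simp only [Set.mem_preimage, h n le_rfl]

/-- The quenched Markov property integrated over the environment. Almost surely the walk starts at
`0`, so the environment at the walker is the first component of the `n`-th iterate, the form in
which `particleShift`-invariance can be used. -/
theorem annealed_inter_invariant (ν : Measure (Environment d)) [SFinite ν]
    {E : Set (Environment d × (ℕ → Lattice d))}
    (hE : MeasurableSet E) (hinv : particleShift ⁻¹' E = E) (n : ℕ)
    {C : Set (Environment d × (ℕ → Lattice d))} (hC : MeasurableSet C)
    (hCn : ∀ ω, DependsUpTo n (Prod.mk ω ⁻¹' C)) :
    annealed ν (C ∩ E) = ∫⁻ z in C, quenchedProb E (particleShift^[n] z).1 ∂annealed ν := by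
  have h1 : ∫⁻ z in C, quenchedProb E (particleShift^[n] z).1 ∂annealed ν =
      ∫⁻ z in C, quenchedProb E (shift (z.2 n) z.1) ∂annealed ν := by
    refine lintegral_congr_ae (ae_restrict_of_ae ?_)
    filter_upwards [ae_annealed_zero ν] with z hz
    rw [particleShift_iterate_fst n hz]
  have hf : Measurable fun z : Environment d × (ℕ → Lattice d) =>
      quenchedProb E (shift (z.2 n) z.1) :=
    (measurable_quenchedProb hE).comp (measurable_shift.comp
      (measurable_fst.prodMk ((measurable_pathCoord n).comp measurable_snd)))
  rw [h1, ← lintegral_indicator hC, annealed_apply ν (hC.inter hE),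
    lintegral_annealed ν (hf.indicator hC)]
  refine lintegral_congr fun ω => ?_
  rw [quenchedProb, Set.preimage_inter,
    quenched_inter_invariant hE hinv n ω (measurable_prodMk_left hC) (hCn ω),
    ← lintegral_indicator (measurable_prodMk_left hC)]
  rfl

/-- Under an invariant law, the quenched probability of a shift-invariant event is `0` or `1`. -/
theorem quenchedProb_zero_or_one {ν : Measure (Environment d)} [IsProbabilityMeasure ν]
    (hν : envKernel.Invariant ν) {E : Set (Environment d × (ℕ → Lattice d))}
    (hE : MeasurableSet E) (hinv : particleShift ⁻¹' E = E) :
    ∀ᵐ ω ∂ν, quenchedProb E ω = 0 ∨ quenchedProb E ω = 1 := by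
  set P := annealed ν with hP
  have hu := measurable_quenchedProb hE
  have hmp := measurePreserving_particleShift hν
  -- Approximate `E` by a finite-time event `C`. The Markov property at its time horizon `n` gives
  -- `P (C ∩ E) = ∫_C u ∘ θ^n`; replacing `C` by `E` costs at most the symmetric difference because
  -- `u ≤ 1`, and invariance of `P` and `E` removes `θ^n`.
  have key : P E ≤ ∫⁻ z in E, quenchedProb E z.1 ∂P := by
    refine ENNReal.le_of_forall_pos_le_add fun ε hε _ => ?_
    have hε2 : (0 : ℝ≥0∞) < (ε : ℝ≥0∞) / 2 := by
      simpa using hε.ne'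
    obtain ⟨C, ⟨hC, n, hCn⟩, hlt⟩ := exists_measure_symmDiff_lt_of_generateFrom_isSetRing (μ := P)
      isSetRing_finiteTimeSets ⟨{Set.univ}, Set.countable_singleton _, by
        rintro _ rfl
        exact ⟨MeasurableSet.univ, 0, fun _ _ _ _ => Iff.rfl⟩, by simp⟩
      generateFrom_finiteTimeSets hE hε2
    have hEn : (particleShift^[n]) ⁻¹' E = E := by
      rw [Set.preimage_iterate_eq]
      exact Function.iterate_fixed hinv n
    have h1 : ∫⁻ z in E, quenchedProb E z.1 ∂P =
        ∫⁻ z in E, quenchedProb E (particleShift^[n] z).1 ∂P := by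
      have := (hmp.iterate n).setLIntegral_comp_preimage hE (hu.comp measurable_fst)
      rw [hEn] at this
      exact this.symm
    have h2 : P (E \ C) ≤ ε / 2 :=
      (measure_mono (Set.subset_union_right)).trans hlt.le
    have h3 : P (C \ E) ≤ ε / 2 :=
      (measure_mono (Set.subset_union_left)).trans hlt.le
    calc P E ≤ P (C ∩ E) + P (E \ C) := by
          rw [Set.inter_comm]; exact measure_le_inter_add_sdiff _ _ _
      _ = ∫⁻ z in C, quenchedProb E (particleShift^[n] z).1 ∂P + P (E \ C) := by
          rw [hP, annealed_inter_invariant ν hE hinv n hC hCn]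
      _ ≤ (∫⁻ z in E, quenchedProb E (particleShift^[n] z).1 ∂P + P (C \ E)) + P (E \ C) := by
          gcongr
          calc _ ≤ ∫⁻ z in E ∪ (C \ E), quenchedProb E (particleShift^[n] z).1 ∂P :=
                lintegral_mono_set (by simp)
            _ ≤ _ := lintegral_union_le _ _ _
            _ ≤ _ := by
                gcongr
                calc _ ≤ ∫⁻ _ in C \ E, 1 ∂P := lintegral_mono fun z => quenchedProb_le_one _ _
                  _ = _ := by simp
      _ ≤ (∫⁻ z in E, quenchedProb E z.1 ∂P + ε / 2) + ε / 2 := by rw [h1]; gcongr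
      _ = _ := by rw [add_assoc, ENNReal.add_halves]
  -- With this identity `key` reads `∫ u ≤ ∫ u²`. Since `0 ≤ u ≤ 1`, it forces `u² = u` almost
  -- everywhere.
  have h1 : ∫⁻ z in E, quenchedProb E z.1 ∂P =
      ∫⁻ ω, quenchedProb E ω * quenchedProb E ω ∂ν := by
    rw [← lintegral_indicator hE, hP,
      lintegral_annealed ν (Measurable.indicator (by fun_prop) hE)]
    refine lintegral_congr fun ω => ?_
    have : (fun y => E.indicator (fun z => quenchedProb E z.1) (ω, y)) =
        (Prod.mk ω ⁻¹' E).indicator fun _ => quenchedProb E ω := rfl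
    rw [this, lintegral_indicator_const (measurable_prodMk_left hE)]
    rfl
  rw [h1, hP, annealed_apply ν hE] at key
  have h2 := ae_eq_of_ae_le_of_lintegral_le (μ := ν)
    (f := fun ω => quenchedProb E ω * quenchedProb E ω) (g := quenchedProb E)
    (Eventually.of_forall fun ω => mul_le_of_le_one_left' (quenchedProb_le_one E ω))
    (ne_top_of_le_ne_top ENNReal.one_ne_top (by
      calc _ ≤ ∫⁻ _, (1 : ℝ≥0∞) ∂ν := lintegral_mono fun ω =>
            mul_le_one' (quenchedProb_le_one E ω) (quenchedProb_le_one E ω)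
        _ = 1 := by simp)) hu.aemeasurable key
  filter_upwards [h2] with ω hω
  by_cases h0 : quenchedProb E ω = 0
  · exact Or.inl h0
  · refine Or.inr ?_
    have hfin : quenchedProb E ω ≠ ∞ := ne_top_of_le_ne_top ENNReal.one_ne_top
      (quenchedProb_le_one E ω)
    exact (ENNReal.mul_eq_left h0 hfin).1 hω

/-- Maximum principle: a harmonic function bounded by `1` that attains `1` at `ω` must equal `1` at
almost every successor of `ω`. The set `{u_E = 1}` is thus absorbing. -/
theorem envKernel_compl_quenchedProb_eq_one {E : Set (Environment d × (ℕ → Lattice d))}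
    (hE : MeasurableSet E) (hinv : particleShift ⁻¹' E = E) {ω : Environment d}
    (hω : quenchedProb E ω = 1) : ∀ᵐ ω' ∂envKernel ω, quenchedProb E ω' = 1 := by
  have h := ae_eq_of_ae_le_of_lintegral_le (μ := envKernel ω) (f := quenchedProb E)
    (g := fun _ => 1) (Eventually.of_forall (quenchedProb_le_one E))
    (by rw [quenchedProb_harmonic hE hinv, hω]; exact ENNReal.one_ne_top) aemeasurable_const
    (by rw [quenchedProb_harmonic hE hinv, hω]; simp)
  exact h

/-- Conditioning an invariant law on an absorbing set gives an invariant law. -/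
theorem invariant_cond {ν : Measure (Environment d)} [IsProbabilityMeasure ν]
    (hν : envKernel.Invariant ν) {B : Set (Environment d)} (hB : MeasurableSet B)
    (habs : ∀ ω ∈ B, envKernel ω Bᶜ = 0) : envKernel.Invariant (ν[|B]) := by
  -- Mass starting in `B` stays in `B`, so what reaches `A` is at most the total flow into `A ∩ B`,
  -- which is `ν (A ∩ B)`.
  have hle : ∀ A, MeasurableSet A → ∫⁻ ω in B, envKernel ω A ∂ν ≤ ν.restrict B A := by
    intro A hA
    calc ∫⁻ ω in B, envKernel ω A ∂ν = ∫⁻ ω in B, envKernel ω (A ∩ B) ∂ν := by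
          refine setLIntegral_congr_fun hB fun ω hω => ?_
          exact (measure_inter_conull (habs ω hω)).symm
      _ ≤ ∫⁻ ω, envKernel ω (A ∩ B) ∂ν := setLIntegral_le_lintegral _ _
      _ = ν.restrict B A := by
          rw [envKernel_invariant_iff.1 hν _ (hA.inter hB), Measure.restrict_apply hA]
  have heq : ∀ A, MeasurableSet A → ∫⁻ ω in B, envKernel ω A ∂ν = ν.restrict B A := by
    intro A hA
    -- The inequalities for `A` and `Aᶜ` add up to an equality of total masses, so neither can be
    -- strict.
    refine le_antisymm (hle A hA) ?_
    have h1 : ∫⁻ ω in B, envKernel ω A ∂ν + ∫⁻ ω in B, envKernel ω Aᶜ ∂ν =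
        ν.restrict B A + ν.restrict B Aᶜ := by
      rw [← lintegral_add_left (Kernel.measurable_coe _ hA), measure_add_measure_compl hA]
      simp only [measure_add_measure_compl hA, measure_univ, lintegral_one]
    have h2 := hle _ hA.compl
    have h3 : ν.restrict B Aᶜ ≠ ∞ := measure_ne_top _ _
    have h4 : ν.restrict B A + ν.restrict B Aᶜ ≤
        ∫⁻ ω in B, envKernel ω A ∂ν + ν.restrict B Aᶜ := by
      rw [← h1]; gcongr
    exact (ENNReal.add_le_add_iff_right h3).1 h4
  refine envKernel_invariant_iff.2 fun A hA => ?_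
  rw [ProbabilityTheory.cond, lintegral_smul_measure, Measure.smul_apply, heq A hA]

end RWRE

/-! ### The maximal ergodic inequality -/

section MaximalErgodic

variable {α : Type*} {T : α → α} {f : α → ℝ}

/-- The maximum of `0` and the first `N` Birkhoff sums. -/
def birkhoffMax (T : α → α) (f : α → ℝ) : ℕ → α → ℝ
  | 0, _ => 0
  | N + 1, x => max 0 (f x + birkhoffMax T f N (T x))

theorem birkhoffMax_nonneg (N : ℕ) (x : α) : 0 ≤ birkhoffMax T f N x := by
  cases N with
  | zero => exact le_rfl
  | succ N => exact le_max_left _ _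

theorem birkhoffMax_le_succ (N : ℕ) (x : α) : birkhoffMax T f N x ≤ birkhoffMax T f (N + 1) x := by
  induction N generalizing x with
  | zero => exact le_max_left _ _
  | succ N ih =>
    rw [birkhoffMax, birkhoffMax]
    gcongr
    exact ih _

theorem birkhoffSum_le_birkhoffMax (N : ℕ) (x : α) : birkhoffSum T f N x ≤ birkhoffMax T f N x := by
  induction N generalizing x with
  | zero => simp [birkhoffMax]
  | succ N ih =>
    rw [birkhoffSum_succ', birkhoffMax]
    exact le_max_of_le_right (by gcongr; exact ih _)

theorem birkhoffMax_le {C : ℝ} (hC : ∀ x, |f x| ≤ C) (N : ℕ) (x : α) :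
    birkhoffMax T f N x ≤ N * C := by
  have hC0 : 0 ≤ C := (abs_nonneg _).trans (hC x)
  induction N generalizing x with
  | zero => simp [birkhoffMax]
  | succ N ih =>
    rw [birkhoffMax]
    refine max_le (by positivity) ?_
    have := (le_abs_self _).trans (hC x)
    have := ih (T x)
    push_cast
    linarith

variable [MeasurableSpace α] {P : Measure α} [IsProbabilityMeasure P]

theorem measurable_birkhoffMax (hT : Measurable T) (hf : Measurable f) (N : ℕ) :
    Measurable (birkhoffMax T f N) := by
  induction N with
  | zero => exact measurable_const
  | succ N ih => exact measurable_const.max (hf.add (ih.comp hT))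

theorem integrable_of_forall_abs_le (hf : Measurable f) {C : ℝ} (hC : ∀ x, |f x| ≤ C) :
    Integrable f P :=
  Integrable.of_bound hf.aestronglyMeasurable C (Eventually.of_forall hC)

theorem integrable_birkhoffMax (hT : Measurable T) (hf : Measurable f) {C : ℝ}
    (hC : ∀ x, |f x| ≤ C) (N : ℕ) : Integrable (birkhoffMax T f N) P :=
  integrable_of_forall_abs_le (measurable_birkhoffMax hT hf N) (C := N * C) fun x => by
    rw [abs_of_nonneg (birkhoffMax_nonneg N x)]
    exact birkhoffMax_le hC N x

/-- The maximal ergodic inequality. -/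
theorem setIntegral_birkhoffMax_pos_nonneg (hT : MeasurePreserving T P P) (hf : Measurable f)
    {C : ℝ} (hC : ∀ x, |f x| ≤ C) (N : ℕ) : 0 ≤ ∫ x in {x | 0 < birkhoffMax T f N x}, f x ∂P := by
  cases N with
  | zero => simp [birkhoffMax]
  | succ N =>
    have hm := measurable_birkhoffMax hT.measurable hf (N + 1)
    have hi := integrable_birkhoffMax (P := P) hT.measurable hf hC (N + 1)
    have hiT : Integrable (fun x => birkhoffMax T f (N + 1) (T x)) P :=
      hT.integrable_comp_of_integrable hi
    have hs : MeasurableSet {x | 0 < birkhoffMax T f (N + 1) x} :=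
      measurableSet_lt measurable_const hm
    -- Garsia's argument: with `m` the maximum at level `N + 1`, the function `m - m ∘ T` has mean
    -- zero and is dominated pointwise by `f` restricted to `{m > 0}`.
    have h0 : ∫ x, (birkhoffMax T f (N + 1) x - birkhoffMax T f (N + 1) (T x)) ∂P = 0 := by
      rw [integral_sub hi hiT, sub_eq_zero]
      have := integral_map (μ := P) hT.aemeasurable
        (f := birkhoffMax T f (N + 1)) hm.aestronglyMeasurable
      rwa [hT.map_eq] at this
    refine h0.symm.le.trans ?_
    rw [← integral_indicator hs]
    refine integral_mono (hi.sub hiT) ((integrable_of_forall_abs_le hf hC).indicator hs) fun x => ?_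
    have hT0 := birkhoffMax_nonneg (T := T) (f := f) (N + 1) (T x)
    by_cases hx : 0 < birkhoffMax T f (N + 1) x
    · rw [Set.indicator_of_mem (by exact hx)]
      -- Where the maximum is positive it is not attained by `0`, so the recursion is an equality;
      -- monotonicity in `N` then replaces level `N` by `N + 1`.
      have h1 : birkhoffMax T f (N + 1) x = f x + birkhoffMax T f N (T x) := by
        rw [birkhoffMax] at hx ⊢
        exact max_eq_right (by by_contra h; rw [max_eq_left (not_le.1 h).le] at hx; exact hx.false)
      have h2 := birkhoffMax_le_succ (T := T) (f := f) N (T x)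
      change birkhoffMax T f (N + 1) x - birkhoffMax T f (N + 1) (T x) ≤ f x
      linarith
    · rw [Set.indicator_of_notMem (by exact hx)]
      change birkhoffMax T f (N + 1) x - birkhoffMax T f (N + 1) (T x) ≤ 0
      linarith

/-- The sets `{0 < birkhoffMax T f N}` increase to a set of full measure, so the maximal inequality
passes to the whole space by dominated convergence. -/
theorem integral_nonneg_of_ae_exists_birkhoffSum_pos (hT : MeasurePreserving T P P)
    (hf : Measurable f) {C : ℝ} (hC : ∀ x, |f x| ≤ C)
    (h : ∀ᵐ x ∂P, ∃ n, 0 < birkhoffSum T f n x) : 0 ≤ ∫ x, f x ∂P := by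
  have hs : ∀ N, MeasurableSet {x | 0 < birkhoffMax T f N x} := fun N =>
    measurableSet_lt measurable_const (measurable_birkhoffMax hT.measurable hf N)
  have hmono : ∀ x, Monotone fun N => birkhoffMax T f N x := fun x =>
    monotone_nat_of_le_succ fun N => birkhoffMax_le_succ N x
  have hlim : Tendsto (fun N => ∫ x, {x | 0 < birkhoffMax T f N x}.indicator f x ∂P) atTop
      (𝓝 (∫ x, f x ∂P)) := by
    refine tendsto_integral_of_dominated_convergence (fun _ => C)
      (fun N => (hf.indicator (hs N)).aestronglyMeasurable) (integrable_const C)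
      (fun N => Eventually.of_forall fun x => ?_) ?_
    · exact (norm_indicator_le_norm_self f x).trans (hC x)
    · filter_upwards [h] with x hx
      obtain ⟨n, hn⟩ := hx
      refine tendsto_const_nhds.congr' ?_
      filter_upwards [eventually_ge_atTop n] with N hN
      rw [Set.indicator_of_mem]
      exact (hn.trans_le (birkhoffSum_le_birkhoffMax n x)).trans_le (hmono x hN)
  refine ge_of_tendsto' hlim fun N => ?_
  rw [integral_indicator (hs N)]
  exact setIntegral_birkhoffMax_pos_nonneg hT hf hC N

end MaximalErgodic

namespace RWRE

variable {d : ℕ} {ℓ : EuclideanSpace ℝ (Fin d)}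

/-! ### Events that depend only on a half-space -/

/-- The coordinate `x · ℓ` of a lattice point. -/
noncomputable def height (ℓ : EuclideanSpace ℝ (Fin d)) (x : Lattice d) : ℝ := inner ℝ x.toE ℓ

theorem Lattice.toE_add (x y : Lattice d) : (x + y).toE = x.toE + y.toE := by
  ext i; simp [Lattice.toE]

theorem Lattice.toE_zero : (0 : Lattice d).toE = 0 := by
  ext i; simp [Lattice.toE]

theorem Lattice.toE_sub (x y : Lattice d) : (x - y).toE = x.toE - y.toE := by
  ext i; simp [Lattice.toE]

theorem height_add (x y : Lattice d) : height ℓ (x + y) = height ℓ x + height ℓ y := by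
  rw [height, Lattice.toE_add, inner_add_left]; rfl

theorem height_sub (x y : Lattice d) : height ℓ (x - y) = height ℓ x - height ℓ y := by
  rw [height, Lattice.toE_sub, inner_sub_left]; rfl

theorem height_zero : height ℓ (0 : Lattice d) = 0 := by
  rw [height, Lattice.toE_zero, inner_zero_left]

/-- The environments `ω` and `ω'` agree at the sites `x` with `x · ℓ ≥ r`. -/
def AgreeAbove (ℓ : EuclideanSpace ℝ (Fin d)) (r : ℝ) (ω ω' : Environment d) : Prop :=
  ∀ x, r ≤ height ℓ x → ω.1 x = ω'.1 x

/-- The event `A` depends only on the sites `x` with `x · ℓ ≥ r`. -/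
def LocalAbove (ℓ : EuclideanSpace ℝ (Fin d)) (r : ℝ) (A : Set (Environment d)) : Prop :=
  ∀ ω ω', AgreeAbove ℓ r ω ω' → (ω ∈ A ↔ ω' ∈ A)

theorem AgreeAbove.mono {r s : ℝ} (h : r ≤ s) {ω ω' : Environment d}
    (hω : AgreeAbove ℓ r ω ω') : AgreeAbove ℓ s ω ω' := fun x hx => hω x (h.trans hx)

theorem LocalAbove.mono {r s : ℝ} (h : r ≤ s) {A : Set (Environment d)}
    (hA : LocalAbove ℓ s A) : LocalAbove ℓ r A := fun ω ω' hω => hA ω ω' (hω.mono h)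

theorem LocalAbove.compl {r : ℝ} {A : Set (Environment d)} (hA : LocalAbove ℓ r A) :
    LocalAbove ℓ r Aᶜ := fun ω ω' hω => not_congr (hA ω ω' hω)

theorem LocalAbove.inter {r : ℝ} {A B : Set (Environment d)} (hA : LocalAbove ℓ r A)
    (hB : LocalAbove ℓ r B) : LocalAbove ℓ r (A ∩ B) :=
  fun ω ω' hω => and_congr (hA ω ω' hω) (hB ω ω' hω)

theorem LocalAbove.iUnion {ι : Sort*} {r : ℝ} {A : ι → Set (Environment d)}
    (hA : ∀ i, LocalAbove ℓ r (A i)) : LocalAbove ℓ r (⋃ i, A i) := fun ω ω' hω => by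
  simp only [Set.mem_iUnion, hA _ ω ω' hω]

theorem AgreeAbove.shift {r : ℝ} {ω ω' : Environment d} (h : AgreeAbove ℓ r ω ω')
    (e : Lattice d) : AgreeAbove ℓ (r - height ℓ e) (shift e ω) (shift e ω') := fun x hx => by
  funext j
  rw [shift_apply, shift_apply, h (e + x) (by rw [height_add]; linarith)]

theorem LocalAbove.preimage_shift {r : ℝ} {A : Set (Environment d)} (hA : LocalAbove ℓ r A)
    {e : Lattice d} (he : 0 ≤ height ℓ e) : LocalAbove ℓ r (shift e ⁻¹' A) :=
  fun ω ω' h => hA _ _ ((h.shift e).mono (by linarith))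

open Classical in
/-- The environment with the walk frozen at the sites `x` with `x · ℓ < r`. -/
noncomputable def freezeBelow (ℓ : EuclideanSpace ℝ (Fin d)) (r : ℝ) (ω : Environment d) :
    Environment d :=
  ⟨fun x j => if r ≤ height ℓ x then ω.1 x j else Pi.single (M := fun _ => ℝ) x 1 j,
    fun x j => by
      by_cases h : r ≤ height ℓ x
      · simpa only [if_pos h] using ω.2.1 x j
      · simp only [if_neg h]
        by_cases hj : j = x
        · subst hj; simp
        · simp [hj],
    fun x => by
      by_cases h : r ≤ height ℓ x
      · simpa only [if_pos h] using ω.2.2 x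
      · simp only [if_neg h]
        exact hasSum_pi_single x 1⟩

theorem agreeAbove_freezeBelow (r : ℝ) (ω : Environment d) :
    AgreeAbove ℓ r (freezeBelow ℓ r ω) ω := fun x hx => by
  funext j
  simp only [freezeBelow, if_pos hx]

/-- Each row of the frozen environment is either a generator of `halfSpaceSigma ℓ k` or constant.
Point masses in the frozen rows keep the result inside the space of environments. -/
theorem measurable_freezeBelow (k : ℤ) :
    Measurable[halfSpaceSigma ℓ k] (freezeBelow ℓ k) := by
  refine @Measurable.subtype_mk _ _ (halfSpaceSigma ℓ k) _ _ _ ?_ _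
  refine @measurable_pi_lambda _ _ _ (halfSpaceSigma ℓ k) _ _ fun x => ?_
  by_cases h : (k : ℝ) ≤ height ℓ x
  · simp only [if_pos h]
    refine Measurable.mono (comap_measurable (fun ω : Environment d => ω.1 x)) ?_ le_rfl
    exact le_iSup₂ (f := fun (x : Lattice d) (_ : (k : ℝ) ≤ inner ℝ x.toE ℓ) =>
      MeasurableSpace.comap (fun ω : Environment d => ω.1 x) inferInstance) x h
  · simp only [if_neg h]
    exact @measurable_const _ _ _ (halfSpaceSigma ℓ k) _

/-- The `σ`-field of the events that depend only on the sites `x` with `x · ℓ ≥ r`. -/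
abbrev localSigma (ℓ : EuclideanSpace ℝ (Fin d)) (r : ℝ) : MeasurableSpace (Environment d) where
  MeasurableSet' A := LocalAbove ℓ r A
  measurableSet_empty := fun _ _ _ => Iff.rfl
  measurableSet_compl := fun _ hA => hA.compl
  measurableSet_iUnion := fun _ hA => LocalAbove.iUnion hA

/-- Freezing below level `k` does not change membership in an event local above `k`, so such an
event is its own preimage under a map measurable for the half-space field. Locality then becomes a
pointwise condition that can be checked by hand. -/
theorem measurableSet_halfSpaceSigma_iff {k : ℤ} {A : Set (Environment d)} :
    MeasurableSet[halfSpaceSigma ℓ k] A ↔ MeasurableSet A ∧ LocalAbove ℓ k A := by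
  constructor
  · refine fun hA => ⟨halfSpaceSigma_le ℓ k A hA, ?_⟩
    have : halfSpaceSigma ℓ k ≤ localSigma ℓ k := by
      refine iSup₂_le fun x hx => ?_
      rintro _ ⟨s, -, rfl⟩ ω ω' h
      simp only [Set.mem_preimage, h x hx]
    exact this A hA
  · rintro ⟨hA, hl⟩
    have h := measurable_freezeBelow (ℓ := ℓ) k hA
    have h2 : freezeBelow ℓ k ⁻¹' A = A :=
      Set.ext fun ω => hl _ _ (agreeAbove_freezeBelow (k : ℝ) ω)
    rwa [h2] at h

/-- `ν` is absolutely continuous relative to `μ` on the events that depend on a half-space. -/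
def HalfSpaceAC (ℓ : EuclideanSpace ℝ (Fin d)) (ν μ : Measure (Environment d)) : Prop :=
  ∀ r A, MeasurableSet A → LocalAbove ℓ r A → μ A = 0 → ν A = 0

theorem absContOn_iff {k : ℤ} {ν μ : Measure (Environment d)} :
    AbsContOn ℓ k ν μ ↔ ∀ A, MeasurableSet A → LocalAbove ℓ k A → μ A = 0 → ν A = 0 := by
  constructor
  · intro h A hA hl h0
    have hm := measurableSet_halfSpaceSigma_iff.2 ⟨hA, hl⟩
    have := h (s := A)
    rw [trim_measurableSet_eq _ hm, trim_measurableSet_eq _ hm] at this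
    exact this h0
  · refine fun h => Measure.AbsolutelyContinuous.mk fun A hm h0 => ?_
    rw [trim_measurableSet_eq _ hm] at h0 ⊢
    obtain ⟨hA, hl⟩ := measurableSet_halfSpaceSigma_iff.1 hm
    exact h A hA hl h0

theorem exists_int_le (r : ℝ) : ∃ k : ℤ, k ≤ 0 ∧ (k : ℝ) ≤ r :=
  ⟨min 0 ⌊r⌋, min_le_left _ _,
    (Int.cast_le.2 (min_le_right 0 ⌊r⌋)).trans (Int.floor_le r)⟩

theorem halfSpaceAC_iff {ν μ : Measure (Environment d)} :
    HalfSpaceAC ℓ ν μ ↔ ∀ k : ℤ, k ≤ 0 → AbsContOn ℓ k ν μ := by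
  constructor
  · exact fun h k _ => absContOn_iff.2 fun A hA hl => h k A hA hl
  · intro h r A hA hl
    obtain ⟨k, hk, hkr⟩ := exists_int_le r
    exact absContOn_iff.1 (h k hk) A hA (hl.mono hkr)

theorem HalfSpaceAC.ae {ν μ : Measure (Environment d)} (h : HalfSpaceAC ℓ ν μ) {r : ℝ}
    {p : Environment d → Prop} (hp : MeasurableSet {ω | p ω}) (hl : LocalAbove ℓ r {ω | p ω})
    (hμ : ∀ᵐ ω ∂μ, p ω) : ∀ᵐ ω ∂ν, p ω :=
  h r _ hp.compl hl.compl hμ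

/-! ### Locality of the quenched law -/

/-- The paths that stay in `{x : x · ℓ ≥ r}`. -/
def stayAbove (ℓ : EuclideanSpace ℝ (Fin d)) (r : ℝ) : Set (ℕ → Lattice d) :=
  {y | ∀ n, r ≤ height ℓ (y n)}

theorem measurableSet_stayAbove (r : ℝ) : MeasurableSet (stayAbove ℓ r) := by
  have : stayAbove ℓ r = ⋂ n, (fun y : ℕ → Lattice d => y n) ⁻¹' {x | r ≤ height ℓ x} := by
    ext y; simp [stayAbove]
  rw [this]
  exact MeasurableSet.iInter fun n => measurable_pathCoord n (Set.to_countable _).measurableSet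

theorem stayAbove_mono {r s : ℝ} (h : r ≤ s) : stayAbove ℓ s ⊆ stayAbove ℓ r :=
  fun _ hy n => h.trans (hy n)

/-- The probability of a finite path is a product of transition probabilities at the sites it
visits, and on `C` all these sites lie above `r`. -/
theorem quenched_congr_of_agreeAbove_of_dependsUpTo {r : ℝ} {ω ω' : Environment d}
    (h : AgreeAbove ℓ r ω ω') {N : ℕ} {C : Set (ℕ → Lattice d)} (hC : DependsUpTo N C)
    (hr : ∀ y ∈ C, ∀ i ≤ N, r ≤ height ℓ (y i)) : quenched 0 ω C = quenched 0 ω' C := by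
  set S := pathUpTo N '' C with hS
  have hCS : C = pathUpTo N ⁻¹' S := by
    refine Set.Subset.antisymm (Set.subset_preimage_image _ _) ?_
    rintro y ⟨y', hy', hyy'⟩
    exact (hC y' y fun i hi => congrFun hyy' ⟨i, Finset.mem_Iic.2 hi⟩).1 hy'
  have hSm : MeasurableSet S := (Set.to_countable _).measurableSet
  have key : ((quenched 0 ω).map (pathUpTo N)).restrict S =
      ((quenched 0 ω').map (pathUpTo N)).restrict S := by
    refine Measure.ext_of_singleton fun a => ?_
    rw [Measure.restrict_apply (MeasurableSet.singleton a),
      Measure.restrict_apply (MeasurableSet.singleton a)]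
    by_cases ha : a ∈ S
    · rw [Set.inter_eq_left.2 (Set.singleton_subset_iff.2 ha)]
      obtain ⟨p, hp, rfl⟩ := ha
      rw [Measure.map_apply (measurable_pathUpTo N) (MeasurableSet.singleton _),
        Measure.map_apply (measurable_pathUpTo N) (MeasurableSet.singleton _),
        pathUpTo_preimage_singleton, quenched_pathCylinder, quenched_pathCylinder]
      congr 1
      refine Finset.prod_congr rfl fun i hi => ?_
      rw [h (p i) (hr p hp i (Finset.mem_range.1 hi).le)]
    · rw [Set.singleton_inter_eq_empty.2 ha, measure_empty, measure_empty]
  have := congrArg (fun m => m S) key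
  simp only [Measure.restrict_apply_self, Measure.map_apply (measurable_pathUpTo N) hSm,
    ← hCS] at this
  exact this

/-- Staying above `r` forever is the decreasing limit of staying above `r` up to time `n + m`, to
which the finite-time comparison applies. -/
theorem quenched_restrict_stayAbove {r : ℝ} {ω ω' : Environment d} (h : AgreeAbove ℓ r ω ω') :
    (quenched 0 ω).restrict (stayAbove ℓ r) = (quenched 0 ω').restrict (stayAbove ℓ r) := by
  refine measure_ext_of_pathCylinder fun n p => ?_
  let D : ℕ → Set (ℕ → Lattice d) := fun m =>
    pathCylinder n p ∩ ⋂ i, ⋂ (_ : i ≤ n + m), (fun y : ℕ → Lattice d => y i) ⁻¹'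
      {x | r ≤ height ℓ x}
  have hD : ∀ m, MeasurableSet (D m) := fun m => (measurableSet_pathCylinder n p).inter <|
    MeasurableSet.iInter fun i => MeasurableSet.iInter fun _ =>
      measurable_pathCoord i (Set.to_countable _).measurableSet
  have hmem : ∀ m y, y ∈ D m ↔ y ∈ pathCylinder n p ∧ ∀ i ≤ n + m, r ≤ height ℓ (y i) := by
    intro m y
    simp only [D, Set.mem_inter_iff, Set.mem_iInter, Set.mem_preimage, Set.mem_ofPred_eq]
  have hanti : Antitone D := fun a b hab y hy => by
    rw [hmem] at hy ⊢
    exact ⟨hy.1, fun i hi => hy.2 i (by omega)⟩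
  have hinter : pathCylinder n p ∩ stayAbove ℓ r = ⋂ m, D m := by
    ext y
    simp only [Set.mem_iInter, hmem]
    exact ⟨fun hy m => ⟨hy.1, fun i _ => hy.2 i⟩,
      fun hy => ⟨(hy 0).1, fun i => (hy i).2 i (by omega)⟩⟩
  have heq : ∀ m, quenched 0 ω (D m) = quenched 0 ω' (D m) := fun m =>
    quenched_congr_of_agreeAbove_of_dependsUpTo h (N := n + m) (fun y y' hy => by
      rw [hmem, hmem]
      refine and_congr (forall₂_congr fun i hi => ?_) (forall₂_congr fun i hi => ?_)
      · rw [hy i (by omega)]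
      · rw [hy i hi]) fun y hy => ((hmem m y).1 hy).2
  rw [Measure.restrict_apply (measurableSet_pathCylinder n p),
    Measure.restrict_apply (measurableSet_pathCylinder n p), hinter,
    hanti.measure_iInter (fun m => (hD m).nullMeasurableSet) ⟨0, measure_ne_top _ _⟩,
    hanti.measure_iInter (fun m => (hD m).nullMeasurableSet) ⟨0, measure_ne_top _ _⟩]
  simp only [heq]

/-- The part of `E` on which the walk stays in `{x : x · ℓ ≥ r}`. -/
def stayPart (ℓ : EuclideanSpace ℝ (Fin d)) (r : ℝ)
    (E : Set (Environment d × (ℕ → Lattice d))) : Set (Environment d × (ℕ → Lattice d)) :=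
  {z | z ∈ E ∧ z.2 ∈ stayAbove ℓ r}

theorem measurableSet_stayPart (r : ℝ) {E : Set (Environment d × (ℕ → Lattice d))}
    (hE : MeasurableSet E) : MeasurableSet (stayPart ℓ r E) :=
  hE.inter (measurable_snd (measurableSet_stayAbove r))

theorem quenchedProb_stayPart_mono {r s : ℝ} (h : r ≤ s)
    (E : Set (Environment d × (ℕ → Lattice d))) (ω : Environment d) :
    quenchedProb (stayPart ℓ s E) ω ≤ quenchedProb (stayPart ℓ r E) ω :=
  measure_mono fun _ hy => ⟨hy.1, stayAbove_mono h hy.2⟩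

/-- On the event that the walk stays in `{x : x · ℓ ≥ r}`, where `r ≤ 0`, `E` depends only on the sites `x` with
`x · ℓ ≥ r + s`. -/
def LocalOnStay (ℓ : EuclideanSpace ℝ (Fin d)) (s : ℝ)
    (E : Set (Environment d × (ℕ → Lattice d))) : Prop :=
  ∀ r ≤ 0, ∀ ω ω' y, AgreeAbove ℓ (r + s) ω ω' → y ∈ stayAbove ℓ r →
    ((ω, y) ∈ E ↔ (ω', y) ∈ E)

theorem LocalOnStay.compl {s : ℝ} {E : Set (Environment d × (ℕ → Lattice d))}
    (h : LocalOnStay ℓ s E) : LocalOnStay ℓ s Eᶜ :=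
  fun r hr ω ω' y hω hy => not_congr (h r hr ω ω' y hω hy)

/-- Two dependences on the environment are controlled: that of the event, by `LocalOnStay`, and that
of the law of the confined walk, which sees sites above `r` only. The condition `s ≤ 0` makes
agreement above `r + s` sufficient for both. -/
theorem LocalOnStay.quenchedProb_congr {s : ℝ} (hs : s ≤ 0)
    {E : Set (Environment d × (ℕ → Lattice d))} (hE : MeasurableSet E)
    (h : LocalOnStay ℓ s E) {r : ℝ} (hr : r ≤ 0) {ω ω' : Environment d} (hω : AgreeAbove ℓ (r + s) ω ω') :
    quenchedProb (stayPart ℓ r E) ω = quenchedProb (stayPart ℓ r E) ω' := by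
  have h1 : ∀ ω, quenchedProb (stayPart ℓ r E) ω =
      (quenched 0 ω).restrict (stayAbove ℓ r) (Prod.mk ω ⁻¹' E) := fun ω => by
    rw [Measure.restrict_apply (measurable_prodMk_left hE)]; rfl
  rw [h1, h1, quenched_restrict_stayAbove (hω.mono (by linarith))]
  refine measure_congr ?_
  filter_upwards [ae_restrict_mem (measurableSet_stayAbove r)] with y hy
  exact propext (h r hr ω ω' y hω hy)

/-- The walk is transient in direction `ℓ`. -/
def TransientPath (ℓ : EuclideanSpace ℝ (Fin d)) (y : ℕ → Lattice d) : Prop :=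
  Tendsto (fun n => height ℓ (y n)) atTop atTop

theorem TransientPath.exists_stayAbove {y : ℕ → Lattice d} (h : TransientPath ℓ y) :
    ∃ K : ℕ, y ∈ stayAbove ℓ (-K) := by
  obtain ⟨b, hb⟩ := bddBelow_range_of_tendsto_atTop_atTop h
  obtain ⟨K, hK⟩ := exists_nat_ge (-b)
  exact ⟨K, fun n => (by linarith : (-K : ℝ) ≤ b).trans (hb ⟨n, rfl⟩)⟩

/-- A transient path is bounded below in direction `ℓ`, so up to a null set `E` is the countable
union of its parts staying above `-K`. This turns half-space information into a statement about `E`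
itself. -/
theorem quenchedProb_eq_zero_of_stayPart {E : Set (Environment d × (ℕ → Lattice d))}
    {ω : Environment d} (ht : ∀ᵐ y ∂quenched 0 ω, TransientPath ℓ y)
    (h : ∀ K : ℕ, quenchedProb (stayPart ℓ (-K) E) ω = 0) : quenchedProb E ω = 0 := by
  have h1 := (measure_iUnion_null_iff (μ := quenched 0 ω)).2 h
  refine measure_mono_null_ae ?_ h1
  filter_upwards [ht] with y hy hyE
  obtain ⟨K, hK⟩ := hy.exists_stayAbove
  exact Set.mem_iUnion.2 ⟨K, hyE, hK⟩

theorem quenchedProb_stayPart_eq_zero {E : Set (Environment d × (ℕ → Lattice d))}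
    {ω : Environment d} (h : quenchedProb E ω = 0) (r : ℝ) :
    quenchedProb (stayPart ℓ r E) ω = 0 :=
  measure_mono_null (fun _ hy => hy.1) h

/-! ### Consequences of ergodicity under the lattice shifts -/

theorem Lattice.norm_toE_single (i : Fin d) (a : ℤ) :
    ‖Lattice.toE (Pi.single i a : Lattice d)‖ = |(a : ℝ)| := by
  have : Lattice.toE (Pi.single i a : Lattice d) = EuclideanSpace.single i (a : ℝ) := by
    ext j
    by_cases hj : j = i
    · subst hj; simp [Lattice.toE]
    · simp [Lattice.toE, hj]
  rw [this, PiLp.norm_single, Real.norm_eq_abs]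

theorem measure_preimage_shift (μ : Measure (Environment d))
    [VAddInvariantMeasure (Lattice d) (Environment d) μ] (e : Lattice d)
    {B : Set (Environment d)} (hB : MeasurableSet B) : μ (shift e ⁻¹' B) = μ B :=
  VAddInvariantMeasure.measure_preimage_vadd e hB

open scoped Pointwise in
/-- An event that is stable under the shifts by the unit vectors `e` with `e · ℓ ≥ 0` is
trivial. -/
theorem measure_eq_zero_or_compl_of_shift (μ : Measure (Environment d)) [IsProbabilityMeasure μ]
    (hergodic : ErgodicVAdd (Lattice d) (Environment d) μ) {B : Set (Environment d)}
    (hB : MeasurableSet B)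
    (h : ∀ e : Lattice d, ‖e.toE‖ = 1 → 0 ≤ height ℓ e → ∀ᵐ ω ∂μ, ω ∈ B → shift e ω ∈ B) :
    μ B = 0 ∨ μ Bᶜ = 0 := by
  let G : AddSubgroup (Lattice d) := AddAction.aestabilizer (Lattice d) μ B
  have hG : ∀ e : Lattice d, ‖e.toE‖ = 1 → 0 ≤ height ℓ e → e ∈ G := by
    intro e he he'
    -- `B` is a.e. contained in its preimage, and the two have the same finite measure.
    have h1 : B =ᵐ[μ] shift e ⁻¹' B := ae_eq_of_ae_subset_of_measure_ge (h e he he')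
      (measure_preimage_shift μ e hB).le hB.nullMeasurableSet (measure_ne_top _ _)
    rw [← neg_mem_iff]
    refine AddAction.mem_aestabilizer.2 ?_
    rw [← Set.preimage_vadd]
    exact h1.symm
  have hsingle : ∀ i : Fin d, (Pi.single i 1 : Lattice d) ∈ G := by
    intro i
    have hneg : (Pi.single i (-1) : Lattice d) = -Pi.single i 1 := Pi.single_neg i 1
    -- One of the two unit vectors along axis `i` has nonnegative height, and the stabilizer is a
    -- group, so it contains both.
    rcases le_total 0 (height ℓ (Pi.single i 1)) with h0 | h0
    · exact hG _ (by rw [Lattice.norm_toE_single]; simp) h0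
    · rw [← neg_mem_iff, ← hneg]
      refine hG _ (by rw [Lattice.norm_toE_single]; simp) ?_
      rw [hneg, ← zero_sub, height_sub, height_zero]
      linarith
  have htop : G = ⊤ := by
    refine (AddSubgroup.eq_top_iff' _).2 fun g => ?_
    rw [← Finset.univ_sum_single g]
    refine sum_mem fun i _ => ?_
    have : (Pi.single i (g i) : Lattice d) = g i • Pi.single i 1 := by
      rw [← Pi.single_smul]; simp
    rw [this]
    exact zsmul_mem (hsingle i) _
  have hconst := AddAction.aeconst_of_aestabilizer_eq_top (Lattice d) hB.nullMeasurableSet htop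
  rcases eventuallyConst_set'.1 hconst with h1 | h1
  · exact Or.inl (ae_eq_empty.1 h1)
  · exact Or.inr (ae_eq_univ.1 h1)

end RWRE

namespace RWRE

variable {d : ℕ} {ℓ : EuclideanSpace ℝ (Fin d)} {μ ν : Measure (Environment d)}

/-! ### Mutual absolute continuity, transience and the zero-one dichotomy -/

/-- The law `μ` is ergodic, weakly elliptic and transient in direction `ℓ`, and `ν` is invariant
for the environment process and absolutely continuous relative to `μ` in half-spaces. -/
structure IsInvariantFor (ℓ : EuclideanSpace ℝ (Fin d)) (μ ν : Measure (Environment d)) :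
    Prop where
  ergodic : ErgodicVAdd (Lattice d) (Environment d) μ
  elliptic : WeaklyElliptic ℓ μ
  transient : ∀ᵐ ω ∂μ, ∀ᵐ y ∂quenched 0 ω, TransientPath ℓ y
  invariant : envKernel.Invariant ν
  ac : HalfSpaceAC ℓ ν μ

theorem of_ae_envKernel {p : Environment d → Prop} (hp : MeasurableSet {ω | p ω})
    {ω : Environment d} (h : ∀ᵐ ω' ∂envKernel ω, p ω') {e : Lattice d} (he : 0 < ω.1 0 e) :
    p (shift e ω) := by
  rw [ae_iff] at h
  have hm : MeasurableSet {ω' | ¬ p ω'} := hp.compl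
  rw [← lintegral_indicator_one hm, lintegral_envKernel ω (measurable_one.indicator hm),
    ENNReal.tsum_eq_zero] at h
  by_contra hne
  have := h e
  rw [Set.indicator_of_mem (by exact hne)] at this
  simp only [Pi.one_apply, mul_one, ENNReal.ofReal_eq_zero] at this
  exact absurd he (not_lt.2 this)

theorem IsInvariantFor.ae_pos (h : IsInvariantFor ℓ μ ν) {e : Lattice d} (he : ‖e.toE‖ = 1)
    (he' : 0 ≤ height ℓ e) : ∀ᵐ ω ∂ν, 0 < ω.1 0 e := by
  refine h.ac.ae (r := 0) (measurableSet_lt measurable_const (measurable_coord 0 e)) ?_ ?_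
  · intro ω ω' hω
    simp only [Set.mem_ofPred_eq, hω 0 height_zero.ge]
  · filter_upwards [h.elliptic] with ω hω
    exact hω e he' he

/-- By invariance, almost no environment jumps into the null set `A`; ellipticity says the jump `e`
has positive probability, so `shift e ω ∉ A` for almost every `ω`. -/
theorem IsInvariantFor.measure_preimage_shift_eq_zero (h : IsInvariantFor ℓ μ ν) {e : Lattice d}
    (he : ‖e.toE‖ = 1) (he' : 0 ≤ height ℓ e) {A : Set (Environment d)} (hA : MeasurableSet A)
    (h0 : ν A = 0) : ν (shift e ⁻¹' A) = 0 := by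
  have h1 : ∀ᵐ ω ∂ν, envKernel ω A = 0 := by
    rw [← envKernel_invariant_iff.1 h.invariant A hA,
      lintegral_eq_zero_iff (Kernel.measurable_coe _ hA)] at h0
    exact h0
  rw [measure_eq_zero_iff_ae_notMem]
  filter_upwards [h1, h.ae_pos he he'] with ω hω hpos
  exact of_ae_envKernel (p := (· ∉ A)) hA.compl (measure_eq_zero_iff_ae_notMem.1 hω) hpos

/-- `μ` is absolutely continuous relative to `ν` in half-spaces. -/
theorem IsInvariantFor.ac_symm [IsProbabilityMeasure μ] [IsProbabilityMeasure ν]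
    (h : IsInvariantFor ℓ μ ν) : HalfSpaceAC ℓ μ ν := by
  intro r A hA hl h0
  let S : Set (Lattice d) := {e | ‖e.toE‖ = 1 ∧ 0 ≤ height ℓ e}
  let Y : AddSubmonoid (Lattice d) := AddSubmonoid.closure S
  have hY : ∀ y ∈ Y, ν (shift y ⁻¹' A) = 0 ∧ 0 ≤ height ℓ y := by
    intro y hy
    induction hy using AddSubmonoid.closure_induction_left with
    | zero =>
      refine ⟨?_, height_zero.ge⟩
      have : shift 0 ⁻¹' A = A := Set.ext fun ω => by rw [Set.mem_preimage, shift_zero]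
      rw [this, h0]
    | add_left e he y _ ih =>
      refine ⟨?_, by rw [height_add]; exact add_nonneg he.2 ih.2⟩
      have : shift (e + y) ⁻¹' A = shift e ⁻¹' (shift y ⁻¹' A) := Set.ext fun ω => by
        rw [Set.mem_preimage, Set.mem_preimage, Set.mem_preimage, shift_shift]
      rw [this]
      exact h.measure_preimage_shift_eq_zero he.1 he.2 (measurable_shift_const y hA) ih.1
  -- `Y` is a countable monoid of vectors of nonnegative height, so `U` is still `ν`-null and
  -- depends on the same half-space as `A`.
  let U : Set (Environment d) := ⋃ y : Y, shift (y : Lattice d) ⁻¹' A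
  have hU : MeasurableSet U := MeasurableSet.iUnion fun y => measurable_shift_const _ hA
  have hUl : LocalAbove ℓ r U := LocalAbove.iUnion fun y => hl.preimage_shift (hY y y.2).2
  have hUν : ν U = 0 := measure_iUnion_null fun y => (hY y y.2).1
  have hshift : ∀ e : Lattice d, ‖e.toE‖ = 1 → 0 ≤ height ℓ e →
      ∀ᵐ ω ∂μ, ω ∈ Uᶜ → shift e ω ∈ Uᶜ := by
    refine fun e he he' => Eventually.of_forall fun ω hω hω' => hω ?_
    obtain ⟨y, hy⟩ := Set.mem_iUnion.1 hω'
    refine Set.mem_iUnion.2 ⟨⟨e + y, Y.add_mem (AddSubmonoid.subset_closure ⟨he, he'⟩) y.2⟩, ?_⟩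
    rw [Set.mem_preimage, shift_shift] at hy
    exact hy
  -- If `μ Uᶜ = 0`, then `ν Uᶜ = 0` because `Uᶜ` is local, against `ν U = 0`. So `μ U = 0`, and `A ⊆
  -- U`.
  rcases measure_eq_zero_or_compl_of_shift μ h.ergodic hU.compl hshift with h1 | h1
  · have h2 := h.ac r _ hU.compl hUl.compl h1
    rw [prob_compl_eq_zero_iff hU] at h2
    exact absurd (h2.symm.trans hUν) one_ne_zero
  · rw [compl_compl] at h1
    refine measure_mono_null (fun ω hω => ?_) h1
    exact Set.mem_iUnion.2 ⟨⟨0, Y.zero_mem⟩, by rwa [Set.mem_preimage, shift_zero]⟩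

theorem IsInvariantFor.cond [IsProbabilityMeasure ν] (h : IsInvariantFor ℓ μ ν)
    {B : Set (Environment d)} (hB : MeasurableSet B) (habs : ∀ ω ∈ B, envKernel ω Bᶜ = 0) :
    IsInvariantFor ℓ μ (ν[|B]) where
  ergodic := h.ergodic
  elliptic := h.elliptic
  transient := h.transient
  invariant := invariant_cond h.invariant hB habs
  ac := fun r A hA hl h0 => cond_absolutelyContinuous (h.ac r A hA hl h0)

theorem measurableSet_transientPath (ℓ : EuclideanSpace ℝ (Fin d)) :
    MeasurableSet {z : Environment d × (ℕ → Lattice d) | TransientPath ℓ z.2} :=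
  measurableSet_tendsto atTop fun n => (measurable_of_countable (height ℓ)).comp
    ((measurable_pathCoord n).comp measurable_snd)

theorem transientPath_particleShift (z : Environment d × (ℕ → Lattice d)) :
    TransientPath ℓ (particleShift z).2 ↔ TransientPath ℓ z.2 := by
  have : TransientPath ℓ (particleShift z).2 ↔
      Tendsto (fun n => height ℓ (z.2 (n + 1)) + -height ℓ (z.2 1)) atTop atTop := by
    simp only [TransientPath, particleShift, height_sub]
    simp only [sub_eq_add_neg]
  rw [this, TransientPath, ← tendsto_add_atTop_iff_nat (f := fun n => height ℓ (z.2 n)) 1]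
  exact ⟨fun h => by simpa using tendsto_atTop_add_const_right _ (height ℓ (z.2 1)) h,
    fun h => tendsto_atTop_add_const_right _ _ h⟩

theorem quenchedProb_eq_one_iff {E : Set (Environment d × (ℕ → Lattice d))}
    (hE : MeasurableSet E) {ω : Environment d} : quenchedProb E ω = 1 ↔ quenchedProb Eᶜ ω = 0 :=
  (prob_compl_eq_zero_iff (measurable_prodMk_left hE)).symm

theorem localAbove_quenchedProb_stayPart {s : ℝ} (hs : s ≤ 0)
    {E : Set (Environment d × (ℕ → Lattice d))} (hE : MeasurableSet E) (hl : LocalOnStay ℓ s E)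
    (K : ℕ) : LocalAbove ℓ (-K + s) {ω | quenchedProb (stayPart ℓ (-K) E) ω = 0} :=
  fun ω ω' hω => by
    simp only [Set.mem_ofPred_eq, hl.quenchedProb_congr hs hE (neg_nonpos.2 K.cast_nonneg) hω]

theorem measurableSet_quenchedProb_eq {E : Set (Environment d × (ℕ → Lattice d))}
    (hE : MeasurableSet E) (c : ℝ≥0∞) : MeasurableSet {ω | quenchedProb E ω = c} :=
  measurable_quenchedProb hE (MeasurableSet.singleton c)

theorem HalfSpaceAC.ae_stayPart_eq_zero (h : HalfSpaceAC ℓ ν μ)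
    {s : ℝ} (hs : s ≤ 0) {E : Set (Environment d × (ℕ → Lattice d))} (hE : MeasurableSet E)
    (hl : LocalOnStay ℓ s E) (h0 : ∀ᵐ ω ∂μ, quenchedProb E ω = 0) :
    ∀ᵐ ω ∂ν, ∀ K : ℕ, quenchedProb (stayPart ℓ (-K) E) ω = 0 :=
  ae_all_iff.2 fun K => h.ae (measurableSet_quenchedProb_eq (measurableSet_stayPart _ hE) 0)
    (localAbove_quenchedProb_stayPart hs hE hl K)
    (h0.mono fun _ hω => quenchedProb_stayPart_eq_zero hω _)

/-- The walk is transient in direction `ℓ` also under the invariant law. -/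
theorem IsInvariantFor.transient_invariant [IsProbabilityMeasure μ] [IsProbabilityMeasure ν]
    (h : IsInvariantFor ℓ μ ν) : ∀ᵐ ω ∂ν, ∀ᵐ y ∂quenched 0 ω, TransientPath ℓ y := by
  set E : Set (Environment d × (ℕ → Lattice d)) := {z | TransientPath ℓ z.2} with hEdef
  have hE : MeasurableSet E := measurableSet_transientPath ℓ
  have hinv : particleShift ⁻¹' E = E := Set.ext transientPath_particleShift
  have hinvc : particleShift ⁻¹' Eᶜ = Eᶜ := by rw [Set.preimage_compl, hinv]
  have hl : LocalOnStay ℓ 0 E := fun _ _ _ _ _ _ _ => Iff.rfl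
  have hae : ∀ ω, quenchedProb Eᶜ ω = 0 ↔ ∀ᵐ y ∂quenched 0 ω, TransientPath ℓ y :=
    fun ω => Iff.rfl
  have hμ : ∀ᵐ ω ∂μ, quenchedProb Eᶜ ω = 0 := h.transient
  have hν := h.ac.ae_stayPart_eq_zero le_rfl hE.compl hl.compl hμ
  let B : Set (Environment d) := {ω | quenchedProb Eᶜ ω = 1}
  have hB : MeasurableSet B := measurableSet_quenchedProb_eq hE.compl 1
  -- Suppose `B`, where transience fails almost surely, has positive mass. Under `ν[|B]` confinement
  -- above any `-K` is null: its transient part by definition of `B`, its nontransient part by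
  -- transfer from `μ`. As `μ ≪ ν[|B]` on half-spaces, confinement is null under `μ` as well,
  -- contradicting transience there.
  have hB0 : ν B = 0 := by
    by_contra hne
    have : IsProbabilityMeasure (ν[|B]) := cond_isProbabilityMeasure hne
    have h' : IsInvariantFor ℓ μ (ν[|B]) := h.cond hB fun ω hω =>
      envKernel_compl_quenchedProb_eq_one hE.compl hinvc hω
    have h1 : ∀ᵐ ω ∂ν[|B], ∀ K : ℕ, quenchedProb (stayPart ℓ (-K) Set.univ) ω = 0 := by
      filter_upwards [cond_absolutelyContinuous.ae_le hν, ae_cond_mem hB] with ω hω hωB K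
      have h2 : quenchedProb (stayPart ℓ (-K) E) ω = 0 :=
        quenchedProb_stayPart_eq_zero
          (by rw [← compl_compl E]; exact (quenchedProb_eq_one_iff hE.compl).1 hωB) _
      refine measure_mono_null (fun y hy => ?_) (measure_union_null h2 (hω K))
      by_cases hyE : (ω, y) ∈ E
      · exact Or.inl ⟨hyE, hy.2⟩
      · exact Or.inr ⟨hyE, hy.2⟩
    have h2 : ∀ᵐ ω ∂μ, ∀ K : ℕ, quenchedProb (stayPart ℓ (-K) Set.univ) ω = 0 := by
      refine ae_all_iff.2 fun K => h'.ac_symm.ae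
        (measurableSet_quenchedProb_eq (measurableSet_stayPart _ MeasurableSet.univ) 0)
        (localAbove_quenchedProb_stayPart (s := 0) le_rfl MeasurableSet.univ
          (fun _ _ _ _ _ _ _ => Iff.rfl) K) (h1.mono fun ω hω => hω K)
    obtain ⟨ω, hω, ht⟩ := (h2.and h.transient).exists
    have := quenchedProb_eq_zero_of_stayPart ht hω
    rw [quenchedProb, Set.preimage_univ, measure_univ] at this
    exact one_ne_zero this
  filter_upwards [quenchedProb_zero_or_one h.invariant hE.compl hinvc,
    measure_eq_zero_iff_ae_notMem.1 hB0] with ω hω hωB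
  exact hω.resolve_right hωB

/-- The confined parts of a `μ`-null event are half-space events and hence `ν`-null; transience
under `ν` reassembles them. -/
theorem IsInvariantFor.ae_quenchedProb_eq_zero [IsProbabilityMeasure μ] [IsProbabilityMeasure ν]
    (h : IsInvariantFor ℓ μ ν) {s : ℝ} (hs : s ≤ 0)
    {E : Set (Environment d × (ℕ → Lattice d))} (hE : MeasurableSet E) (hl : LocalOnStay ℓ s E)
    (h0 : ∀ᵐ ω ∂μ, quenchedProb E ω = 0) : ∀ᵐ ω ∂ν, quenchedProb E ω = 0 := by
  filter_upwards [h.ac.ae_stayPart_eq_zero hs hE hl h0, h.transient_invariant] with ω hω ht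
  exact quenchedProb_eq_zero_of_stayPart ht hω

/-- A shift-invariant event that is local along the walk has probability `0` both under `μ` and
under `ν`, or probability `1` under both. -/
theorem IsInvariantFor.zero_one [IsProbabilityMeasure μ] [IsProbabilityMeasure ν]
    (h : IsInvariantFor ℓ μ ν) {s : ℝ} (hs : s ≤ 0)
    {E : Set (Environment d × (ℕ → Lattice d))} (hE : MeasurableSet E)
    (hinv : particleShift ⁻¹' E = E) (hl : LocalOnStay ℓ s E) :
    ((∀ᵐ ω ∂μ, quenchedProb E ω = 0) ∧ ∀ᵐ ω ∂ν, quenchedProb E ω = 0) ∨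
      ((∀ᵐ ω ∂μ, quenchedProb E ω = 1) ∧ ∀ᵐ ω ∂ν, quenchedProb E ω = 1) := by
  have h1 : ∀ᵐ ω ∂ν, ∀ K : ℕ, quenchedProb (stayPart ℓ (-K) E) ω = 0 ∨
      quenchedProb (stayPart ℓ (-K) Eᶜ) ω = 0 := by
    filter_upwards [quenchedProb_zero_or_one h.invariant hE hinv] with ω hω K
    refine hω.imp (fun h0 => quenchedProb_stayPart_eq_zero h0 _) fun h0 => ?_
    exact quenchedProb_stayPart_eq_zero ((quenchedProb_eq_one_iff hE).1 h0) _
  have h2 : ∀ᵐ ω ∂μ, ∀ K : ℕ, quenchedProb (stayPart ℓ (-K) E) ω = 0 ∨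
      quenchedProb (stayPart ℓ (-K) Eᶜ) ω = 0 := by
    -- The zero-one law is available under `ν` only. Its confined version, that for each `K` the
    -- part of `E` or the part of `Eᶜ` is null, depends on a half-space and so passes to `μ`.
    refine ae_all_iff.2 fun K => h.ac_symm.ae (r := -K + s) ?_ ?_ (h1.mono fun ω hω => hω K)
    · exact (measurableSet_quenchedProb_eq (measurableSet_stayPart _ hE) 0).union
        (measurableSet_quenchedProb_eq (measurableSet_stayPart _ hE.compl) 0)
    · exact fun ω ω' hω => or_congr (localAbove_quenchedProb_stayPart hs hE hl K ω ω' hω)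
        (localAbove_quenchedProb_stayPart hs hE.compl hl.compl K ω ω' hω)
  have h3 : ∀ᵐ ω ∂μ, quenchedProb E ω = 0 ∨ quenchedProb E ω = 1 := by
    filter_upwards [h2, h.transient] with ω hω ht
    by_cases ha : ∀ K : ℕ, quenchedProb (stayPart ℓ (-K) E) ω = 0
    · exact Or.inl (quenchedProb_eq_zero_of_stayPart ht ha)
    · refine Or.inr ((quenchedProb_eq_one_iff hE).2
        (quenchedProb_eq_zero_of_stayPart ht fun K => ?_))
      obtain ⟨K', hK'⟩ := not_forall.1 ha
      -- The alternative could a priori change with `K`. Nullity at a larger `K` implies nullity at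
      -- a smaller one, so if `E` has positive confined probability at `K'`, the complement is null
      -- at every level.
      have hmono : ∀ (F : Set (Environment d × (ℕ → Lattice d))) {a b : ℕ}, a ≤ b →
          quenchedProb (stayPart ℓ (-b) F) ω = 0 → quenchedProb (stayPart ℓ (-a) F) ω = 0 :=
        fun F a b hab hb => le_antisymm ((quenchedProb_stayPart_mono
          (neg_le_neg (Nat.cast_le.2 hab)) F ω).trans hb.le) zero_le
      exact hmono _ (le_max_left K K')
        ((hω (max K K')).resolve_left fun h0 => hK' (hmono _ (le_max_right K K') h0))
  have hB : MeasurableSet {ω | quenchedProb E ω = 1} := measurableSet_quenchedProb_eq hE 1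
  -- `{u_E = 1}` is absorbing and elliptic jumps have positive probability, so it is stable under
  -- the shifts by unit vectors of nonnegative height.
  rcases measure_eq_zero_or_compl_of_shift (ℓ := ℓ) μ h.ergodic hB fun e he he' => by
      filter_upwards [h.elliptic] with ω hω hωB
      exact of_ae_envKernel hB (envKernel_compl_quenchedProb_eq_one hE hinv hωB) (hω e he' he)
    with h4 | h4
  · have h5 : ∀ᵐ ω ∂μ, quenchedProb E ω = 0 := by
      filter_upwards [h3, measure_eq_zero_iff_ae_notMem.1 h4] with ω hω hωB
      exact hω.resolve_right hωB
    exact Or.inl ⟨h5, h.ae_quenchedProb_eq_zero hs hE hl h5⟩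
  · have h5 : ∀ᵐ ω ∂μ, quenchedProb E ω = 1 := h4
    refine Or.inr ⟨h5, ?_⟩
    filter_upwards [h.ae_quenchedProb_eq_zero hs hE.compl hl.compl
      (h5.mono fun ω hω => (quenchedProb_eq_one_iff hE).1 hω)] with ω hω
    exact (quenchedProb_eq_one_iff hE).2 hω

end RWRE

/-! ### Upper limits of Birkhoff averages as shift-invariant events -/

section BirkhoffExceeds

variable {α : Type*} {T : α → α} {f : α → ℝ}

/-- The points at which the upper limit of the Birkhoff averages of `f` exceeds `c`. -/
def birkhoffExceeds (T : α → α) (f : α → ℝ) (c : ℝ) : Set α :=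
  {x | ∃ q : ℚ, c < q ∧ ∃ᶠ n in atTop, (q : ℝ) < birkhoffAverage ℝ T f n x}

theorem tendsto_birkhoffAverage_apply_sub {C : ℝ} (hC : ∀ x, |f x| ≤ C) (x : α) :
    Tendsto (fun n => birkhoffAverage ℝ T f n (T x) - birkhoffAverage ℝ T f n x) atTop (𝓝 0) := by
  refine tendsto_birkhoffAverage_apply_sub_birkhoffAverage ℝ ?_
  refine (Metric.isBounded_closedBall (x := (0 : ℝ)) (r := C)).subset ?_
  rintro _ ⟨n, rfl⟩
  simpa using hC _

/-- A vanishing perturbation is absorbed by the gap between `c` and the rational level `q`. This is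
why the event uses such a gap: it becomes exactly invariant, not merely up to null sets. -/
theorem exists_frequently_lt_of_tendsto_sub {u v : ℕ → ℝ}
    (h : Tendsto (fun n => u n - v n) atTop (𝓝 0)) {c : ℝ}
    (hu : ∃ q : ℚ, c < q ∧ ∃ᶠ n in atTop, (q : ℝ) < u n) :
    ∃ q : ℚ, c < q ∧ ∃ᶠ n in atTop, (q : ℝ) < v n := by
  obtain ⟨q, hcq, hq⟩ := hu
  obtain ⟨q', hcq', hq'⟩ := exists_rat_btwn hcq
  refine ⟨q', hcq', (hq.and_eventually (h.eventually_lt_const (sub_pos.2 hq'))).mono ?_⟩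
  rintro n ⟨h1, h2⟩
  linarith

theorem preimage_birkhoffExceeds {C : ℝ} (hC : ∀ x, |f x| ≤ C) (c : ℝ) :
    T ⁻¹' birkhoffExceeds T f c = birkhoffExceeds T f c := by
  ext x
  have h := tendsto_birkhoffAverage_apply_sub (T := T) hC x
  refine ⟨exists_frequently_lt_of_tendsto_sub h, exists_frequently_lt_of_tendsto_sub ?_⟩
  simpa using h.neg

/-- The margins `1 / (j + 1)` tend to zero, so the first family bounds the upper limit by `I`; the
second, for `-f`, bounds the lower limit. -/
theorem tendsto_birkhoffAverage_of_notMem_birkhoffExceeds {x : α} {I : ℝ}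
    (h1 : ∀ j : ℕ, x ∉ birkhoffExceeds T f (I + 1 / (j + 1)))
    (h2 : ∀ j : ℕ, x ∉ birkhoffExceeds T (-f) (-I + 1 / (j + 1))) :
    Tendsto (fun n => birkhoffAverage ℝ T f n x) atTop (𝓝 I) := by
  have key : ∀ (g : α → ℝ) (J : ℝ), (∀ j : ℕ, x ∉ birkhoffExceeds T g (J + 1 / (j + 1))) →
      ∀ b, J < b → ∀ᶠ n in atTop, birkhoffAverage ℝ T g n x < b := by
    intro g J hg b hb
    obtain ⟨j, hj⟩ := exists_nat_one_div_lt (sub_pos.2 hb)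
    obtain ⟨q, hq1, hq2⟩ := exists_rat_btwn (show J + 1 / ((j : ℝ) + 1) < b by linarith)
    have : ¬ ∃ᶠ n in atTop, (q : ℝ) < birkhoffAverage ℝ T g n x := fun h => hg j ⟨q, hq1, h⟩
    rw [not_frequently] at this
    exact this.mono fun n hn => (not_lt.1 hn).trans_lt hq2
  refine tendsto_order.2 ⟨fun a ha => ?_, key f I h1⟩
  refine (key (-f) (-I) h2 (-a) (neg_lt_neg ha)).mono fun n hn => ?_
  rw [birkhoffAverage_neg] at hn
  exact neg_lt_neg_iff.1 hn

variable [MeasurableSpace α] {P : Measure α}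

theorem measurable_birkhoffAverage (hT : Measurable T) (hf : Measurable f) (n : ℕ) :
    Measurable (birkhoffAverage ℝ T f n) := by
  have : birkhoffAverage ℝ T f n = fun x => (n : ℝ)⁻¹ • ∑ k ∈ Finset.range n, f (T^[k] x) := rfl
  rw [this]
  exact (Finset.measurable_sum _ fun k _ => hf.comp (hT.iterate k)).const_smul (n : ℝ)⁻¹

theorem measurableSet_birkhoffExceeds (hT : Measurable T) (hf : Measurable f) (c : ℝ) :
    MeasurableSet (birkhoffExceeds T f c) := by
  have : birkhoffExceeds T f c = ⋃ q : ℚ, ⋃ (_ : c < q),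
      limsup (fun n => {x | (q : ℝ) < birkhoffAverage ℝ T f n x}) atTop := by
    ext x
    simp only [birkhoffExceeds, Set.mem_ofPred_eq, Set.mem_iUnion, mem_limsup_iff_frequently_mem,
      exists_prop]
  rw [this]
  exact MeasurableSet.iUnion fun q => MeasurableSet.iUnion fun _ =>
    MeasurableSet.measurableSet_limsup fun n =>
      measurableSet_lt measurable_const (measurable_birkhoffAverage hT hf n)

theorem le_integral_of_ae_mem_birkhoffExceeds [IsProbabilityMeasure P]
    (hT : MeasurePreserving T P P) (hf : Measurable f) {C : ℝ} (hC : ∀ x, |f x| ≤ C) {c : ℝ}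
    (h : ∀ᵐ x ∂P, x ∈ birkhoffExceeds T f c) : c ≤ ∫ x, f x ∂P := by
  -- An average above `q > c` at a time `n ≥ 1` is a positive Birkhoff sum of `f - c`, so the
  -- maximal inequality applies to `f - c`.
  have h1 : 0 ≤ ∫ x, (f x - c) ∂P := by
    refine integral_nonneg_of_ae_exists_birkhoffSum_pos hT (hf.sub_const c) (C := C + |c|)
      (fun x => (abs_sub _ _).trans (by gcongr; exact hC x)) ?_
    filter_upwards [h] with x hx
    obtain ⟨q, hcq, hq⟩ := hx
    obtain ⟨n, hn, hn1⟩ := (hq.and_eventually (eventually_ge_atTop 1)).exists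
    refine ⟨n, ?_⟩
    have hn0 : (0 : ℝ) < n := by exact_mod_cast hn1
    have h2 : birkhoffSum T (fun x => f x - c) n x = birkhoffSum T f n x - n * c := by
      simp [birkhoffSum, Finset.sum_sub_distrib]
    have h3 : (n : ℝ) * birkhoffAverage ℝ T f n x = birkhoffSum T f n x := by
      rw [birkhoffAverage, smul_eq_mul, mul_inv_cancel_left₀ hn0.ne']
    rw [h2, ← h3, ← mul_sub]
    exact mul_pos hn0 (by linarith)
  rw [integral_sub (integrable_of_forall_abs_le hf hC) (integrable_const c)] at h1
  simpa using h1

end BirkhoffExceeds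

namespace RWRE

variable {d : ℕ} {ℓ : EuclideanSpace ℝ (Fin d)} {μ ν : Measure (Environment d)}

/-! ### Law of large numbers for local functions, uniqueness and ergodicity -/

/-- The function `F` depends only on the path and on the sites `x` with `x · ℓ ≥ s`. -/
def LocalFunction (ℓ : EuclideanSpace ℝ (Fin d)) (s : ℝ)
    (F : Environment d × (ℕ → Lattice d) → ℝ) : Prop :=
  ∀ ω ω' y, AgreeAbove ℓ s ω ω' → F (ω, y) = F (ω', y)

theorem LocalFunction.neg {s : ℝ} {F : Environment d × (ℕ → Lattice d) → ℝ}
    (hF : LocalFunction ℓ s F) : LocalFunction ℓ s (-F) :=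
  fun ω ω' y h => congrArg Neg.neg (hF ω ω' y h)

theorem LocalFunction.comp_iterate {s : ℝ} {F : Environment d × (ℕ → Lattice d) → ℝ}
    (hF : LocalFunction ℓ s F) {r : ℝ} (hr : r ≤ 0) {ω ω' : Environment d} {y : ℕ → Lattice d}
    (h : AgreeAbove ℓ (r + s) ω ω') (hy : y ∈ stayAbove ℓ r) (n : ℕ) :
    F (particleShift^[n] (ω, y)) = F (particleShift^[n] (ω', y)) := by
  cases n with
  -- The zeroth iterate does not recentre at `y 0`; here `r ≤ 0` is what makes agreement above `r +
  -- s` enough.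
  | zero => exact hF _ _ _ (h.mono (by linarith))
  | succ n =>
    rw [particleShift_iterate_succ, particleShift_iterate_succ]
    exact hF _ _ _ ((h.shift _).mono (by have := hy (n + 1); linarith))

/-- Seen from a walker at height at least `r`, a function local above `s` reads only original sites
above `r + s`. All Birkhoff averages thus agree, which is the locality that `zero_one` requires. -/
theorem LocalFunction.localOnStay_birkhoffExceeds {s : ℝ}
    {F : Environment d × (ℕ → Lattice d) → ℝ} (hF : LocalFunction ℓ s F) (c : ℝ) :
    LocalOnStay ℓ s (birkhoffExceeds particleShift F c) := by
  intro r hr ω ω' y hω hy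
  have : ∀ n, birkhoffAverage ℝ particleShift F n (ω, y) =
      birkhoffAverage ℝ particleShift F n (ω', y) := fun n => by
    simp only [birkhoffAverage, birkhoffSum, hF.comp_iterate hr hω hy]
  simp only [birkhoffExceeds, Set.mem_ofPred_eq, this]

/-- The upper limit of the averages of a bounded local function is at most its mean under `ν`. -/
theorem IsInvariantFor.ae_notMem_birkhoffExceeds [IsProbabilityMeasure μ] [IsProbabilityMeasure ν]
    (h : IsInvariantFor ℓ μ ν) {s : ℝ} (hs : s ≤ 0) {F : Environment d × (ℕ → Lattice d) → ℝ}
    (hF : Measurable F) {C : ℝ} (hC : ∀ z, |F z| ≤ C) (hl : LocalFunction ℓ s F) {c : ℝ}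
    (hc : ∫ z, F z ∂annealed ν < c) :
    ∀ᵐ z ∂annealed μ, z ∉ birkhoffExceeds particleShift F c := by
  have hE := measurableSet_birkhoffExceeds measurable_particleShift hF c
  -- Probability one under `ν` would force `c` to be at most the `ν`-mean; the other alternative
  -- gives probability zero under `μ` too.
  rcases h.zero_one hs hE (preimage_birkhoffExceeds hC c)
    (hl.localOnStay_birkhoffExceeds c) with h1 | h1
  · rw [← measure_eq_zero_iff_ae_notMem, annealed_apply μ hE]
    rw [lintegral_eq_zero_iff (measurable_quenchedProb hE)]
    exact h1.1
  · have h2 := le_integral_of_ae_mem_birkhoffExceeds (measurePreserving_particleShift h.invariant)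
      hF hC ((annealed_eq_one_iff ν hE).2 h1.2)
    exact absurd hc (not_lt.2 h2)

/-- Law of large numbers for bounded local functions under the annealed law. -/
theorem IsInvariantFor.tendsto_birkhoffAverage [IsProbabilityMeasure μ] [IsProbabilityMeasure ν]
    (h : IsInvariantFor ℓ μ ν) {s : ℝ} (hs : s ≤ 0) {F : Environment d × (ℕ → Lattice d) → ℝ}
    (hF : Measurable F) {C : ℝ} (hC : ∀ z, |F z| ≤ C) (hl : LocalFunction ℓ s F) :
    ∀ᵐ z ∂annealed μ, Tendsto (fun n => birkhoffAverage ℝ particleShift F n z) atTop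
      (𝓝 (∫ z, F z ∂annealed ν)) := by
  have hpos : ∀ j : ℕ, (0 : ℝ) < 1 / ((j : ℝ) + 1) := fun j => Nat.one_div_pos_of_nat
  have h1 := ae_all_iff.2 fun j : ℕ => h.ae_notMem_birkhoffExceeds hs hF hC hl
    (c := ∫ z, F z ∂annealed ν + 1 / ((j : ℝ) + 1)) (by linarith [hpos j])
  have h2 := ae_all_iff.2 fun j : ℕ => h.ae_notMem_birkhoffExceeds hs hF.neg (C := C)
    (fun z => by rw [Pi.neg_apply, abs_neg]; exact hC z) hl.neg
    (c := -∫ z, F z ∂annealed ν + 1 / ((j : ℝ) + 1))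
    (by simp only [Pi.neg_apply, integral_neg]; linarith [hpos j])
  filter_upwards [h1, h2] with z hz1 hz2
  exact tendsto_birkhoffAverage_of_notMem_birkhoffExceeds hz1 hz2

/-- The indicator function of an event of environments. -/
noncomputable def envIndicator (A : Set (Environment d)) (z : Environment d × (ℕ → Lattice d)) :
    ℝ :=
  A.indicator 1 z.1

theorem measurable_envIndicator {A : Set (Environment d)} (hA : MeasurableSet A) :
    Measurable (envIndicator A) := (measurable_one.indicator hA).comp measurable_fst

theorem abs_envIndicator_le (A : Set (Environment d)) (z : Environment d × (ℕ → Lattice d)) :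
    |envIndicator A z| ≤ 1 := by
  rw [envIndicator, ← Real.norm_eq_abs]
  refine (norm_indicator_le_norm_self _ _).trans ?_
  simp

theorem LocalAbove.localFunction {r : ℝ} {A : Set (Environment d)} (hA : LocalAbove ℓ r A) :
    LocalFunction ℓ r (envIndicator A) :=
  fun ω ω' _ h => indicator_eq_indicator_of_iff (hA ω ω' h) rfl

theorem integral_envIndicator (ν : Measure (Environment d)) [IsProbabilityMeasure ν]
    {A : Set (Environment d)} (hA : MeasurableSet A) :
    ∫ z, envIndicator A z ∂annealed ν = ν.real A := by
  have hfst : (annealed ν).map Prod.fst = ν := by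
    rw [annealed]; exact Measure.fst_compProd ν (quenchedKernel 0)
  have := integral_map (μ := annealed ν) measurable_fst.aemeasurable
    (f := A.indicator (1 : Environment d → ℝ)) (measurable_one.indicator hA).aestronglyMeasurable
  rw [hfst, integral_indicator_one hA] at this
  exact this.symm

theorem IsInvariantFor.tendsto_envIndicator [IsProbabilityMeasure μ] [IsProbabilityMeasure ν]
    (h : IsInvariantFor ℓ μ ν) {r : ℝ} {A : Set (Environment d)} (hA : MeasurableSet A)
    (hl : LocalAbove ℓ r A) :
    ∀ᵐ z ∂annealed μ, Tendsto (fun n => birkhoffAverage ℝ particleShift (envIndicator A) n z) atTop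
      (𝓝 (ν.real A)) := by
  -- The locality level is lowered to `min r 0` because the law of large numbers requires a
  -- nonpositive one.
  have := h.tendsto_birkhoffAverage (min_le_right r 0) (measurable_envIndicator hA)
    (abs_envIndicator_le A) (hl.mono (min_le_left r 0)).localFunction
  rwa [integral_envIndicator ν hA] at this

theorem generateFrom_localAbove (ℓ : EuclideanSpace ℝ (Fin d)) :
    (inferInstance : MeasurableSpace (Environment d)) =
      MeasurableSpace.generateFrom {A | MeasurableSet A ∧ ∃ r, LocalAbove ℓ r A} := by
  refine le_antisymm ?_ (MeasurableSpace.generateFrom_le fun s hs => hs.1)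
  change MeasurableSpace.comap Subtype.val MeasurableSpace.pi ≤ _
  rw [MeasurableSpace.pi, MeasurableSpace.comap_iSup]
  refine iSup_le fun x => ?_
  rintro _ ⟨_, ⟨s, hs, rfl⟩, rfl⟩
  refine MeasurableSpace.measurableSet_generateFrom
    ⟨((measurable_pi_apply x).comp measurable_subtype_coe) hs, height ℓ x, fun ω ω' h => ?_⟩
  simp only [Set.mem_preimage, h x le_rfl]

theorem isPiSystem_localAbove (ℓ : EuclideanSpace ℝ (Fin d)) :
    IsPiSystem {A : Set (Environment d) | MeasurableSet A ∧ ∃ r, LocalAbove ℓ r A} := by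
  rintro A ⟨hA, r, hr⟩ B ⟨hB, s, hs⟩ -
  exact ⟨hA.inter hB, min r s,
    (hr.mono (min_le_left r s)).inter (hs.mono (min_le_right r s))⟩

/-- Uniqueness of the invariant law. -/
theorem IsInvariantFor.unique [IsProbabilityMeasure μ] [IsProbabilityMeasure ν]
    (h : IsInvariantFor ℓ μ ν) {ν' : Measure (Environment d)} [IsProbabilityMeasure ν']
    (h' : IsInvariantFor ℓ μ ν') : ν' = ν := by
  refine ext_of_generate_finite _ (generateFrom_localAbove ℓ) (isPiSystem_localAbove ℓ) ?_
    (by rw [measure_univ, measure_univ])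
  rintro A ⟨hA, r, hl⟩
  -- The same `μ`-typical trajectory has limiting frequency `ν A` and `ν' A`.
  obtain ⟨z, hz, hz'⟩ := ((h.tendsto_envIndicator hA hl).and (h'.tendsto_envIndicator hA hl)).exists
  exact (measureReal_eq_measureReal_iff).1 (tendsto_nhds_unique hz' hz)

/-- If `{u_E = 1}` has positive `ν`-measure, conditioning `ν` on it gives an invariant law
absolutely continuous in half-spaces, which equals `ν` by uniqueness; so `u_E = 1` almost surely.
Otherwise the zero-one law gives `u_E = 0`. -/
theorem IsInvariantFor.ergodic_particleShift [IsProbabilityMeasure μ] [IsProbabilityMeasure ν]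
    (h : IsInvariantFor ℓ μ ν) : Ergodic particleShift (annealed ν) := by
  refine ⟨measurePreserving_particleShift h.invariant, ⟨fun E hE hinv => ?_⟩⟩
  let B : Set (Environment d) := {ω | quenchedProb E ω = 1}
  have hB : MeasurableSet B := measurableSet_quenchedProb_eq hE 1
  rw [eventuallyConst_set']
  by_cases hB0 : ν B = 0
  · refine Or.inl (ae_eq_empty.2 ?_)
    rw [annealed_apply ν hE, lintegral_eq_zero_iff (measurable_quenchedProb hE)]
    filter_upwards [quenchedProb_zero_or_one h.invariant hE hinv,
      measure_eq_zero_iff_ae_notMem.1 hB0] with ω hω hωB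
    exact hω.resolve_right hωB
  · refine Or.inr (eventuallyEq_univ.2 ?_)
    have : IsProbabilityMeasure (ν[|B]) := cond_isProbabilityMeasure hB0
    have h1 : ν[|B] = ν := h.unique (h.cond hB fun ω hω =>
      envKernel_compl_quenchedProb_eq_one hE hinv hω)
    refine (annealed_eq_one_iff ν hE).2 ?_
    have h2 := ae_cond_mem (μ := ν) hB
    rwa [h1] at h2

theorem envProcess_particleShift (z : Environment d × (ℕ → Lattice d)) (n : ℕ) :
    envProcess (particleShift z) n = envProcess z (n + 1) := by
  simp only [envProcess, particleShift, shift_shift, add_sub_cancel]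

/-- Ergodicity of the environment process under its invariant law. -/
theorem IsInvariantFor.ergodic_envProcessLaw [IsProbabilityMeasure μ] [IsProbabilityMeasure ν]
    (h : IsInvariantFor ℓ μ ν) :
    Ergodic (fun (s : ℕ → Environment d) (n : ℕ) => s (n + 1)) (envProcessLaw ν) := by
  have hm : Measurable fun (s : ℕ → Environment d) (n : ℕ) => s (n + 1) :=
    measurable_pi_lambda _ fun n => measurable_pi_apply (n + 1)
  refine MeasurePreserving.ergodic_of_ergodic_semiconj (g := envProcess)
    ⟨measurable_envProcess, rfl⟩ h.ergodic_particleShift hm fun z => ?_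
  exact funext fun n => envProcess_particleShift z n

end RWRE

namespace RWRE

variable {d : ℕ} {ℓ : EuclideanSpace ℝ (Fin d)} {μ ν : Measure (Environment d)}

/-! ### Weak convergence of the Cesàro averages -/

/-- A basic open set of the product topology constrains finitely many sites, and these have a lowest
height. Weak convergence can thus be tested on half-space events. -/
theorem exists_localAbove_nhds (ℓ : EuclideanSpace ℝ (Fin d)) {u : Set (Environment d)}
    (hu : IsOpen u) {ω : Environment d} (hω : ω ∈ u) :
    ∃ A, (MeasurableSet A ∧ ∃ r, LocalAbove ℓ r A) ∧ A ∈ 𝓝 ω ∧ A ⊆ u := by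
  obtain ⟨V, hV, rfl⟩ := isOpen_induced_iff.1 hu
  obtain ⟨I, U, hU, hIU⟩ := isOpen_pi_iff.1 hV ω.1 hω
  have hopen : IsOpen (Subtype.val ⁻¹' (I : Set (Lattice d)).pi U : Set (Environment d)) :=
    (isOpen_set_pi I.finite_toSet fun x hx => (hU x hx).1).preimage continuous_subtype_val
  refine ⟨Subtype.val ⁻¹' (I : Set (Lattice d)).pi U, ⟨?_, ?_⟩,
    hopen.mem_nhds fun x hx => (hU x hx).2, Set.preimage_mono hIU⟩
  · exact measurable_subtype_coe (MeasurableSet.pi I.countable_toSet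
      fun x hx => (hU x hx).1.measurableSet)
  · obtain ⟨r, hr⟩ := (I.image (height ℓ)).bddBelow
    refine ⟨r, fun ω ω' h => ?_⟩
    simp only [Set.mem_preimage, Set.mem_pi]
    refine forall₂_congr fun x hx => ?_
    rw [h x (hr (Finset.mem_image_of_mem _ hx))]

/-- The Cesàro sum runs over times `1, …, n`, whereas a Birkhoff sum runs over `0, …, n - 1`; the
average is therefore evaluated at `particleShift z`. -/
theorem cesaro_real_eq [IsProbabilityMeasure μ] (n : ℕ) {A : Set (Environment d)}
    (hA : MeasurableSet A) : (cesaro μ n).real A =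
      ∫ z, birkhoffAverage ℝ particleShift (envIndicator A) n (particleShift z) ∂annealed μ := by
  have hm : ∀ k, Measurable fun z : Environment d × (ℕ → Lattice d) => envProcess z k :=
    fun k => (measurable_pi_apply k).comp measurable_envProcess
  have h1 : ∀ k (z : Environment d × (ℕ → Lattice d)),
      envIndicator A (particleShift^[k] (particleShift z)) =
        ((fun z => envProcess z (k + 1)) ⁻¹' A).indicator 1 z := by
    intro k z
    rw [← Function.iterate_succ_apply, particleShift_iterate_succ]
    exact indicator_eq_indicator_of_iff Iff.rfl rfl
  have h2 : ∀ k, Integrable (((fun z => envProcess z (k + 1)) ⁻¹' A).indicator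
      (1 : Environment d × (ℕ → Lattice d) → ℝ)) (annealed μ) := fun k =>
    (integrable_const (1 : ℝ)).indicator (hm _ hA)
  simp only [birkhoffAverage, birkhoffSum, h1]
  rw [integral_smul, integral_finsetSum _ fun k _ => h2 k, measureReal_def, cesaro,
    Measure.smul_apply, Measure.finsetSum_apply, smul_eq_mul, ENNReal.toReal_mul,
    ENNReal.toReal_sum fun k _ => measure_ne_top _ _, smul_eq_mul, ENNReal.toReal_inv,
    ENNReal.toReal_natCast, ← Finset.Ico_succ_right_eq_Icc, Finset.sum_Ico_eq_sum_range]
  congr 1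
  refine Finset.sum_congr (by simp) fun k _ => ?_
  rw [integral_indicator_one (hm _ hA), Measure.map_apply (hm _) hA, add_comm]
  rfl

theorem IsInvariantFor.tendsto_cesaroProb [IsProbabilityMeasure μ]
    {ν : ProbabilityMeasure (Environment d)} (h : IsInvariantFor ℓ μ ν) :
    Tendsto (cesaroProb μ) atTop (𝓝 ν) := by
  have : SecondCountableTopology (Lattice d → Lattice d → ℝ) := inferInstance
  have : SecondCountableTopology (Environment d) :=
    TopologicalSpace.Subtype.secondCountableTopology _
  refine (isPiSystem_localAbove ℓ).tendsto_probabilityMeasure_of_tendsto_of_mem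
    (fun A hA => hA.1) (fun u hu ω hω => exists_localAbove_nhds ℓ hu hω) ?_
  rintro A ⟨hA, r, hl⟩
  rw [← NNReal.tendsto_coe]
  have h1 : ∀ n, ((cesaroProb μ n A : NNReal) : ℝ) =
      ∫ z, birkhoffAverage ℝ particleShift (envIndicator A) (n + 1) (particleShift z)
        ∂annealed μ := fun n => cesaro_real_eq (n + 1) hA
  have h2 : ((ν A : NNReal) : ℝ) = ∫ _, (ν : Measure (Environment d)).real A ∂annealed μ := by
    simp
  simp only [h1]
  rw [h2]
  have hmeas : ∀ n, Measurable fun z : Environment d × (ℕ → Lattice d) =>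
      birkhoffAverage ℝ particleShift (envIndicator A) (n + 1) (particleShift z) := fun n =>
    (measurable_birkhoffAverage measurable_particleShift (measurable_envIndicator hA) _).comp
      measurable_particleShift
  refine tendsto_integral_of_dominated_convergence (fun _ => 1)
    (fun n => (hmeas n).aestronglyMeasurable) (integrable_const 1)
    (fun n => Eventually.of_forall fun z => ?_) ?_
  · rw [birkhoffAverage, birkhoffSum, norm_smul, norm_inv, Real.norm_natCast]
    calc _ ≤ ((n + 1 : ℕ) : ℝ)⁻¹ * ((n + 1 : ℕ) : ℝ) := by
          gcongr
          refine (norm_sum_le_of_le _ fun k _ => abs_envIndicator_le A _).trans ?_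
          simp
      _ = 1 := inv_mul_cancel₀ (by positivity)
  · filter_upwards [h.tendsto_envIndicator hA hl] with z hz
    -- Moving the starting point by one step changes a bounded average by a vanishing amount.
    have h3 := (tendsto_birkhoffAverage_apply_sub (T := particleShift)
      (abs_envIndicator_le A) z).add hz
    simp only [sub_add_cancel, zero_add] at h3
    exact h3.comp (tendsto_add_atTop_nat 1)

/-! ### Law of large numbers for the walk -/

theorem Lattice.abs_coord_le_norm (x : Lattice d) (i : Fin d) : |(x i : ℝ)| ≤ ‖x.toE‖ :=
  PiLp.norm_apply_le x.toE i

theorem finite_norm_toE_le (M : ℝ) : {x : Lattice d | ‖x.toE‖ ≤ M}.Finite := by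
  refine (Set.finite_Icc (fun _ => -⌈M⌉ : Lattice d) fun _ => ⌈M⌉).subset fun x hx => ?_
  have h : ∀ i, |x i| ≤ ⌈M⌉ := fun i => by
    have := ((Lattice.abs_coord_le_norm x i).trans hx).trans (Int.le_ceil M)
    exact_mod_cast this
  exact ⟨fun i => (abs_le.1 (h i)).1, fun i => (abs_le.1 (h i)).2⟩

theorem ae_quenched_of_step {ω : Environment d} {p : (ℕ → Lattice d) → Prop}
    (hp : MeasurableSet {y | p y})
    (h : ∀ e, ω.1 0 e = 0 ∨ ∀ᵐ y ∂quenched 0 (shift e ω), p (consPath e y)) :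
    ∀ᵐ y ∂quenched 0 ω, p y := by
  have hm : MeasurableSet {y | ¬ p y} := hp.compl
  rw [ae_iff, quenched_zero_eq_sum, Measure.sum_apply _ hm, ENNReal.tsum_eq_zero]
  intro e
  rw [Measure.smul_apply, Measure.map_apply (measurable_consPath e) hm, smul_eq_mul]
  rcases h e with h0 | h0
  · rw [h0, ENNReal.ofReal_zero, zero_mul]
  · rw [show quenched 0 (shift e ω) (consPath e ⁻¹' {y | ¬ p y}) = 0 from h0, mul_zero]

theorem measurableSet_norm_step_le (M : ℝ) (n : ℕ) :
    MeasurableSet {y : ℕ → Lattice d | ‖(y (n + 1) - y n).toE‖ ≤ M} :=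
  ((measurable_pathCoord (n + 1)).sub (measurable_pathCoord n))
    (Set.to_countable {x : Lattice d | ‖x.toE‖ ≤ M}).measurableSet

theorem ae_quenched_norm_step_le {M : ℝ} (n : ℕ) {ω : Environment d}
    (hω : ∀ i j : Lattice d, M < ‖(i - j).toE‖ → ω.1 i j = 0) :
    ∀ᵐ y ∂quenched 0 ω, ‖(y (n + 1) - y n).toE‖ ≤ M := by
  induction n generalizing ω with
  | zero =>
    refine ae_quenched_of_step (measurableSet_norm_step_le M 0) fun e => ?_
    rcases lt_or_ge M ‖e.toE‖ with h | h
    · refine Or.inl (hω 0 e ?_)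
      rwa [Lattice.toE_sub, Lattice.toE_zero, zero_sub, norm_neg]
    · refine Or.inr ((ae_quenched_zero _).mono fun y hy => ?_)
      simpa [consPath, hy] using h
  | succ n ih =>
    refine ae_quenched_of_step (measurableSet_norm_step_le M (n + 1)) fun e => Or.inr ?_
    refine (ih (ω := shift e ω) fun i j hij => hω _ _ ?_).mono fun y hy => ?_
    · rwa [add_sub_add_left_eq_sub]
    · simpa only [consPath, add_sub_add_left_eq_sub] using hy

theorem ae_annealed_norm_step_le [IsProbabilityMeasure μ] {M : ℝ} (h : FiniteRange M μ) :
    ∀ᵐ z ∂annealed μ, ∀ n, ‖(z.2 (n + 1) - z.2 n).toE‖ ≤ M :=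
  ae_all_iff.2 fun n => (ae_annealed_iff μ (measurable_snd (measurableSet_norm_step_le M n))).2
    (h.mono fun _ hω => ae_quenched_norm_step_le n hω)

/-- For fixed `i` and `j` the event `ω.1 i j = 0` reads the single site `i`, so it transfers from
`μ` to `ν`; there are countably many pairs. -/
theorem HalfSpaceAC.finiteRange (h : HalfSpaceAC ℓ ν μ) {M : ℝ} (hM : FiniteRange M μ) :
    FiniteRange M ν := by
  refine ae_all_iff.2 fun i => ae_all_iff.2 fun j => ?_
  by_cases hij : M < ‖(i - j).toE‖
  · have h1 : ∀ᵐ ω ∂ν, ω.1 i j = 0 :=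
      h.ae (r := height ℓ i) (measurable_coord i j (MeasurableSet.singleton 0))
        (fun ω ω' hω => by simp only [Set.mem_ofPred_eq, hω i le_rfl])
        (hM.mono fun ω hω => hω i j hij)
    exact h1.mono fun ω hω _ => hω
  · exact Eventually.of_forall fun ω h' => absurd h' hij

open Classical in
/-- The `i`-th coordinate of the first step of the walk, if this step has length at most `M`. -/
noncomputable def firstStep (M : ℝ) (i : Fin d) (z : Environment d × (ℕ → Lattice d)) : ℝ :=
  if ‖(z.2 1).toE‖ ≤ M then (z.2 1 i : ℝ) else 0

theorem measurable_firstStep (M : ℝ) (i : Fin d) : Measurable (firstStep M i) := by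
  classical
  exact (measurable_of_countable fun x : Lattice d => if ‖x.toE‖ ≤ M then (x i : ℝ) else 0).comp
    ((measurable_pathCoord 1).comp measurable_snd)

theorem abs_firstStep_le (M : ℝ) (i : Fin d) (z : Environment d × (ℕ → Lattice d)) :
    |firstStep M i z| ≤ |M| := by
  rw [firstStep]
  split_ifs with h
  · exact ((Lattice.abs_coord_le_norm _ i).trans h).trans (le_abs_self M)
  · simp

theorem firstStep_iterate {M : ℝ} (i : Fin d) {z : Environment d × (ℕ → Lattice d)}
    (hz : z.2 0 = 0) (hM : ∀ n, ‖(z.2 (n + 1) - z.2 n).toE‖ ≤ M) (k : ℕ) :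
    firstStep M i (particleShift^[k] z) = (z.2 (k + 1) i : ℝ) - z.2 k i := by
  have h1 : (particleShift^[k] z).2 1 = z.2 (k + 1) - z.2 k := by
    cases k with
    | zero => simp [hz]
    | succ k => rw [particleShift_iterate_succ]; simp only [add_comm 1 (k + 1)]
  rw [firstStep, h1, if_pos (hM k)]
  simp

/-- Along a path with steps of length at most `M` the truncation is inactive, so the Birkhoff sum
telescopes to the displacement. The truncation makes the observable bounded everywhere, as the law
of large numbers requires. -/
theorem birkhoffAverage_firstStep {M : ℝ} (i : Fin d) {z : Environment d × (ℕ → Lattice d)}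
    (hz : z.2 0 = 0) (hM : ∀ n, ‖(z.2 (n + 1) - z.2 n).toE‖ ≤ M) (n : ℕ) :
    birkhoffAverage ℝ particleShift (firstStep M i) n z = (n : ℝ)⁻¹ * z.2 n i := by
  simp only [birkhoffAverage, birkhoffSum, firstStep_iterate i hz hM]
  rw [Finset.sum_range_sub (fun k => (z.2 k i : ℝ)), hz]
  simp

theorem quenched_coord_one (ω : Environment d) (e : Lattice d) :
    quenched 0 ω {y | y 1 = e} = ENNReal.ofReal (ω.1 0 e) := by
  let p : ℕ → Lattice d := fun n => if n = 0 then 0 else e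
  have h1 : quenched 0 ω {y | y 1 = e} = quenched 0 ω (pathCylinder 1 p) := by
    refine measure_congr ?_
    filter_upwards [ae_quenched_zero ω] with y hy
    refine propext ⟨fun h i hi => ?_, fun h => h 1 le_rfl⟩
    interval_cases i
    · exact hy
    · exact h
  rw [h1, quenched_pathCylinder]
  simp [p]

theorem annealed_real_coord_one [IsProbabilityMeasure ν] (e : Lattice d) :
    (annealed ν).real {z | z.2 1 = e} = ∫ ω, ω.1 0 e ∂ν := by
  have hm : MeasurableSet {z : Environment d × (ℕ → Lattice d) | z.2 1 = e} :=
    ((measurable_pathCoord 1).comp measurable_snd) (MeasurableSet.singleton e)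
  rw [measureReal_def, annealed_apply ν hm,
    integral_eq_lintegral_of_nonneg_ae (Eventually.of_forall fun ω => ω.2.1 0 e)
      (measurable_coord 0 e).aestronglyMeasurable]
  congr 1
  exact lintegral_congr fun ω => quenched_coord_one ω e

theorem integrable_coord [IsProbabilityMeasure ν] (i j : Lattice d) :
    Integrable (fun ω : Environment d => ω.1 i j) ν :=
  integrable_of_forall_abs_le (measurable_coord i j) (C := 1) fun ω => by
    rw [abs_of_nonneg (ω.2.1 i j)]
    exact le_hasSum (ω.2.2 i) j fun k _ => ω.2.1 i k

theorem drift_eq_sum {M : ℝ} {ω : Environment d}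
    (hω : ∀ i j : Lattice d, M < ‖(i - j).toE‖ → ω.1 i j = 0) :
    drift ω = ∑ e ∈ (finite_norm_toE_le M).toFinset, ω.1 0 e • e.toE := by
  refine tsum_eq_sum fun e he => ?_
  rw [hω 0 e, zero_smul]
  rw [Lattice.toE_sub, Lattice.toE_zero, zero_sub, norm_neg]
  simpa using he

theorem FiniteRange.integrable_drift [IsProbabilityMeasure ν] {M : ℝ} (h : FiniteRange M ν) :
    Integrable drift ν := by
  refine (integrable_finsetSum (finite_norm_toE_le M).toFinset fun e _ =>
    (integrable_coord (ν := ν) 0 e).smul_const e.toE).congr ?_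
  filter_upwards [h] with ω hω
  exact (drift_eq_sum hω).symm

theorem FiniteRange.integral_firstStep [IsProbabilityMeasure ν] {M : ℝ} (h : FiniteRange M ν)
    (i : Fin d) : ∫ z, firstStep M i z ∂annealed ν = (∫ ω, drift ω ∂ν) i := by
  classical
  have h1 : ∀ z, firstStep M i z = ∑ e ∈ (finite_norm_toE_le M).toFinset,
      {z : Environment d × (ℕ → Lattice d) | z.2 1 = e}.indicator (fun _ => (e i : ℝ)) z := by
    intro z
    simp only [Set.indicator_apply, Set.mem_ofPred_eq, Finset.sum_ite_eq, Set.Finite.mem_toFinset,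
      firstStep]
  have hm : ∀ e : Lattice d, MeasurableSet {z : Environment d × (ℕ → Lattice d) | z.2 1 = e} :=
    fun e => ((measurable_pathCoord 1).comp measurable_snd) (MeasurableSet.singleton e)
  have h2 : (∫ ω, drift ω ∂ν) i = ∫ ω, drift ω i ∂ν :=
    ((EuclideanSpace.proj (𝕜 := ℝ) i).integral_comp_comm h.integrable_drift).symm
  have h3 : ∫ ω, drift ω i ∂ν =
      ∫ ω, ∑ e ∈ (finite_norm_toE_le (d := d) M).toFinset, ω.1 0 e * (e i : ℝ) ∂ν := by
    refine integral_congr_ae ?_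
    filter_upwards [h] with ω hω
    rw [drift_eq_sum hω, WithLp.ofLp_sum, Finset.sum_apply]
    rfl
  simp only [h1]
  rw [h2, h3, integral_finsetSum _ fun e _ => (integrable_const _).indicator (hm e),
    integral_finsetSum _ fun e _ => (integrable_coord 0 e).mul_const _]
  refine Finset.sum_congr rfl fun e _ => ?_
  rw [integral_indicator_const _ (hm e), annealed_real_coord_one, integral_mul_const, smul_eq_mul]

/-- The law of large numbers for the walk. -/
theorem IsInvariantFor.tendsto_walk [IsProbabilityMeasure μ] [IsProbabilityMeasure ν]
    (h : IsInvariantFor ℓ μ ν) {M : ℝ} (hM : FiniteRange M μ) :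
    ∀ᵐ z ∂annealed μ, Tendsto (fun n : ℕ => (n : ℝ)⁻¹ • (z.2 n).toE) atTop
      (𝓝 (∫ ω, drift ω ∂ν)) := by
  -- The first step reads only the path, so locality holds trivially at level `s = 0`.
  have h1 := ae_all_iff.2 fun i : Fin d => h.tendsto_birkhoffAverage (s := 0) le_rfl
    (measurable_firstStep M i) (abs_firstStep_le M i) fun _ _ _ _ => rfl
  filter_upwards [h1, ae_annealed_zero μ, ae_annealed_norm_step_le hM] with z hz hz0 hzM
  have h2 : Tendsto (fun (n : ℕ) (i : Fin d) => (n : ℝ)⁻¹ * (z.2 n i : ℝ)) atTop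
      (𝓝 fun i => (∫ ω, drift ω ∂ν) i) := by
    refine tendsto_pi_nhds.2 fun i => ?_
    have h3 := hz i
    rw [(h.ac.finiteRange hM).integral_firstStep i] at h3
    simpa only [birkhoffAverage_firstStep i hz0 hzM] using h3
  exact ((PiLp.continuous_toLp 2 fun _ : Fin d => ℝ).tendsto _).comp h2

end RWRE

/-! ### Assembly of the theorem -/

theorem mainTheorem2 {d : ℕ} (ℓ : EuclideanSpace ℝ (Fin d)) (hℓ : ℓ ≠ 0)
    (μ : Measure (RWRE.Environment d)) [IsProbabilityMeasure μ]
    (hergodic : ErgodicVAdd (RWRE.Lattice d) (RWRE.Environment d) μ)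
    (M : ℝ) (hrange : RWRE.FiniteRange M μ)
    (helliptic : RWRE.WeaklyElliptic ℓ μ)
    (htransient : ∀ᵐ p ∂(RWRE.annealed μ),
      Tendsto (fun n : ℕ => inner ℝ (p.2 n).toE ℓ) atTop atTop)
    (μinf : ProbabilityMeasure (RWRE.Environment d))
    (hinv : RWRE.envKernel.Invariant (μinf : Measure (RWRE.Environment d)))
    (hac : ∀ k : ℤ, k ≤ 0 → RWRE.AbsContOn ℓ k μinf μ) :
    -- mutual absolute continuity on every half-space
    (∀ k : ℤ, k ≤ 0 → RWRE.AbsContOn ℓ k μinf μ ∧ RWRE.AbsContOn ℓ k μ μinf) ∧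
    -- ergodicity of the environment process started from the invariant law
    Ergodic (fun (s : ℕ → RWRE.Environment d) (n : ℕ) => s (n + 1)) (RWRE.envProcessLaw μinf) ∧
    -- uniqueness of the invariant law
    (∀ ν : ProbabilityMeasure (RWRE.Environment d),
      RWRE.envKernel.Invariant (ν : Measure (RWRE.Environment d)) →
      (∀ k : ℤ, k ≤ 0 → RWRE.AbsContOn ℓ k ν μ) → ν = μinf) ∧
    -- weak convergence of the Cesàro averages
    Tendsto (RWRE.cesaroProb μ) atTop (𝓝 μinf) ∧
    -- law of large numbers
    Integrable RWRE.drift (μinf : Measure (RWRE.Environment d)) ∧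
    ∀ᵐ p ∂(RWRE.annealed μ),
      Tendsto (fun n : ℕ => (n : ℝ)⁻¹ • (p.2 n).toE) atTop (𝓝 (∫ ω, RWRE.drift ω ∂μinf)) := by
  have hν : ∀ ν : Measure (RWRE.Environment d), RWRE.envKernel.Invariant ν →
      (∀ k : ℤ, k ≤ 0 → RWRE.AbsContOn ℓ k ν μ) → RWRE.IsInvariantFor ℓ μ ν :=
    fun ν h1 h2 => ⟨hergodic, helliptic,
      (RWRE.ae_annealed_iff μ (RWRE.measurableSet_transientPath ℓ)).1 htransient, h1,
      RWRE.halfSpaceAC_iff.2 h2⟩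
  have h := hν μinf hinv hac
  refine ⟨fun k hk => ⟨hac k hk, RWRE.halfSpaceAC_iff.1 h.ac_symm k hk⟩, h.ergodic_envProcessLaw,
    fun ν h1 h2 => ?_, h.tendsto_cesaroProb,
    (h.ac.finiteRange hrange).integrable_drift, h.tendsto_walk hrange⟩
  have h3 : (ν : Measure (RWRE.Environment d)) = μinf := h.unique (hν ν h1 h2)
  exact Subtype.ext h3
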